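/- A polytopological space $(X,\tau_1,\dots,\tau_n)$ is a set $X$ with topologies $\tau_1\supseteq\tau_2\supseteq\dots\supseteq\tau_n$; it is saturated if for all $1\le x,y\le n$ every nonempty $\tau_x$-open set has nonempty $\tau_y$-interior. Let $k_j$, $i_j$, $f_j$ be the closure, interior and frontier (topological boundary) operators of $\tau_j$ on subsets of $X$, and let $c$ be the set complement operator. Let $\mathcal{KF}_n^0$ be the monoid of set operators (under composition) generated by $\{k_j,i_j,f_j:1\le j\le n\}$, and $\mathcal{KF}_n$ the monoid of set operators generated by $\{k_j,f_j:1\le j\le n\}\cup\{c\}$. Put $$p(n)=\tfrac{5}{24}n^4+\tfrac{37}{12}n^3+\tfrac{79}{24}n^2+\tfrac{101}{12}n+2 .$$ Theorem. For every $n\ge 1$ there is a saturated polytopological space $(X,\tau_1,\dots,\tau_n)$ in which $\#\mathcal{KF}_n^0=p(n)$ and $\#\mathcal{KF}_n=2p(n)$. In fact, there is an initial set $A\subseteq X$ such that $\#\{oA:o\in\mathcal{KF}_n\}=2p(n)$. Moreover, the space can be chosen to be a disjoint union of copies of $\mathbb{R}$, where on each copy each of the $n$ topologies is either the Sorgenfrey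 topology (generated by the intervals $[a,b)$) or the Euclidean topology, and each $\tau_j$ is the disjoint union of the $j$-th topologies of the copies. -/

import Mathlib

namespace Polytopological

open scoped Topology

variable {X : Type*} {n : ℕ}

/-- `(X, τ 0, …, τ (n-1))` is an `n`-topological (finite polytopological) space: the topologies
are linearly ordered by inclusion of their families of open sets, `τ 0 ⊇ τ 1 ⊇ … ⊇ τ (n-1)`. -/
def IsPolytopological (τ : Fin n → TopologicalSpace X) : Prop :=
  ∀ i j : Fin n, i ≤ j → ∀ U : Set X, IsOpen[τ j] U → IsOpen[τ i] U

/-- Saturation: a nonempty set that is open in one of the topologies has nonempty interior in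
each of them. -/
def IsSaturated (τ : Fin n → TopologicalSpace X) : Prop :=
  ∀ (x y : Fin n) (U : Set X), IsOpen[τ x] U → U.Nonempty → (@interior X (τ y) U).Nonempty

/-- Set operators on `X`, a monoid under composition: `(o₁ * o₂) A = o₁ (o₂ A)`. -/
abbrev SetOp (X : Type*) : Type _ := Function.End (Set X)

/-- The closure operator `k_j`. -/
def kOp (τ : Fin n → TopologicalSpace X) (j : Fin n) : SetOp X := fun A => @closure X (τ j) A

/-- The interior operator `i_j`. -/
def iOp (τ : Fin n → TopologicalSpace X) (j : Fin n) : SetOp X := fun A => @interior X (τ j) A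

/-- The frontier (topological boundary) operator `f_j`. -/
def fOp (τ : Fin n → TopologicalSpace X) (j : Fin n) : SetOp X := fun A => @frontier X (τ j) A

/-- The complement operator `c`. -/
def cOp (X : Type*) : SetOp X := fun A => Aᶜ

/-- The monoid of set operators generated by all `k_j`, all `f_j` and `c`. -/
def KF (τ : Fin n → TopologicalSpace X) : Submonoid (SetOp X) :=
  Submonoid.closure (Set.range (kOp τ) ∪ Set.range (fOp τ) ∪ {cOp X})

/-- The monoid of set operators generated by all `k_j`, `i_j` and `f_j`. -/
def KF₀ (τ : Fin n → TopologicalSpace X) : Submonoid (SetOp X) :=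
  Submonoid.closure (Set.range (kOp τ) ∪ Set.range (iOp τ) ∪ Set.range (fOp τ))

/-- The orbit `{o A : o ∈ KF}` of an initial set `A`. -/
def orbit (τ : Fin n → TopologicalSpace X) (A : Set X) : Set (Set X) :=
  {B | ∃ o ∈ KF τ, B = o A}

/-- The polynomial `p(n)`. -/
def p (n : ℕ) : ℚ :=
  5 / 24 * (n : ℚ) ^ 4 + 37 / 12 * (n : ℚ) ^ 3 + 79 / 24 * (n : ℚ) ^ 2 + 101 / 12 * (n : ℚ) + 2

/-- The usual (Euclidean) topology of the real line. -/
abbrev euclideanLine : TopologicalSpace ℝ := inferInstance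

/-- The Sorgenfrey topology of the real line, with basic open sets `[a, b)`. -/
abbrev sorgenfreyLine : TopologicalSpace ℝ :=
  TopologicalSpace.generateFrom {s | ∃ a b : ℝ, s = Set.Ico a b}

/-- The `n` topologies on the disjoint union of copies of `ℝ`, one copy for each `a : ι`, where the
copy with index `a` carries the topologies `σ a 0, …, σ a (n-1)`: the `j`-th topology is the
disjoint union topology of the `j`-th topologies of the copies. -/
abbrev sumOfLines {ι : Type*} (σ : ι → Fin n → TopologicalSpace ℝ) (j : Fin n) :
    TopologicalSpace (Σ _ : ι, ℝ) :=
  @instTopologicalSpaceSigma ι (fun _ => ℝ) (fun a => σ a j)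

end Polytopological

namespace Polytopological

open scoped Topology

/-! ### Operator identities forced by saturation -/

section Relations

variable {X : Type*} {n : ℕ} {τ : Fin n → TopologicalSpace X}

/-! Upper bound. Saturation makes inner indices irrelevant: k_x i_y = k_x i_x, i_x k_y = i_x k_x and
i_x f_y = i_x f_x (`kOp_iOp`, `iOp_kOp`, `iOp_fOp`). Moreover f_x k_y = f_x k_max(x,y), and the
frontier of an open or closed set has empty interior in every topology. These rules reduce every
operator of `KF₀` to the identity, the constant ∅, one of eight regular shapes with one index, k_w
f_x, k_w f_x applied to a regular shape, or k_w f_x k_y f_z, with x ≤ w, x ≤ y, z ≤ y. A regular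
closed set and its interior have the same frontier, so three shapes are redundant under f_x when x =
y. The remaining normal words number p(n), and complements at most double them.

Sharpness. Take n + 1 lines; on line t the first t topologies are Sorgenfrey, the others Euclidean.
There a word acts as its image under a threshold map to two letters, and the thresholds together
recover a normal word (`Word.Normal.eq_of_threshold`). It remains to find one set of reals
separating the two-letter normal words. It is a union of classes of a 15-coloring of ℝ in which the
colors accumulating at a point from either side depend only on its color. The operators then act on
sets of colors, and separation is a finite computation. One color is missed by every word, which
separates words from complements. -/

theorem subset_kOp (x : Fin n) (A : Set X) : A ⊆ kOp τ x A := @subset_closure X (τ x) A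

theorem iOp_subset (x : Fin n) (A : Set X) : iOp τ x A ⊆ A := @interior_subset X (τ x) A

theorem kOp_mono (x : Fin n) {A B : Set X} (h : A ⊆ B) : kOp τ x A ⊆ kOp τ x B :=
  @closure_mono X (τ x) A B h

theorem iOp_mono (x : Fin n) {A B : Set X} (h : A ⊆ B) : iOp τ x A ⊆ iOp τ x B :=
  @interior_mono X (τ x) A B h

theorem kOp_idem (x : Fin n) (A : Set X) : kOp τ x (kOp τ x A) = kOp τ x A :=
  @closure_closure X (τ x) A

theorem iOp_idem (x : Fin n) (A : Set X) : iOp τ x (iOp τ x A) = iOp τ x A :=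
  @interior_interior X (τ x) A

theorem kOp_compl (x : Fin n) (A : Set X) : kOp τ x Aᶜ = (iOp τ x A)ᶜ :=
  @closure_compl X (τ x) A

theorem iOp_compl (x : Fin n) (A : Set X) : iOp τ x Aᶜ = (kOp τ x A)ᶜ :=
  @interior_compl X (τ x) A

theorem fOp_compl (x : Fin n) (A : Set X) : fOp τ x Aᶜ = fOp τ x A :=
  @frontier_compl X (τ x) A

theorem fOp_eq_diff (x : Fin n) (A : Set X) : fOp τ x A = kOp τ x A \ iOp τ x A := rfl

theorem kOp_fOp_self (x : Fin n) (A : Set X) : kOp τ x (fOp τ x A) = fOp τ x A :=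
  @IsClosed.closure_eq X (τ x) _ (@isClosed_frontier X (τ x) A)

theorem kOp_iOp_kOp_iOp (x : Fin n) (A : Set X) :
    kOp τ x (iOp τ x (kOp τ x (iOp τ x A))) = kOp τ x (iOp τ x A) :=
  @closure_interior_idem X (τ x) A

theorem iOp_kOp_iOp_kOp (x : Fin n) (A : Set X) :
    iOp τ x (kOp τ x (iOp τ x (kOp τ x A))) = iOp τ x (kOp τ x A) :=
  @interior_closure_idem X (τ x) A

theorem IsPolytopological.kOp_subset (hp : IsPolytopological τ) {x y : Fin n} (h : x ≤ y)
    (A : Set X) : kOp τ x A ⊆ kOp τ y A := by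
  have hc : IsClosed[τ y] (kOp τ y A) := @isClosed_closure X (τ y) A
  refine @closure_minimal X (τ x) _ _ (subset_kOp y A) ?_
  rw [← @isOpen_compl_iff X _ (τ y)] at hc
  rw [← @isOpen_compl_iff X _ (τ x)]
  exact hp x y h _ hc

theorem IsPolytopological.iOp_subset_iOp (hp : IsPolytopological τ) {x y : Fin n} (h : x ≤ y)
    (A : Set X) : iOp τ y A ⊆ iOp τ x A := by
  have := hp.kOp_subset h Aᶜ
  rwa [kOp_compl, kOp_compl, Set.compl_subset_compl] at this

theorem IsPolytopological.kOp_kOp (hp : IsPolytopological τ) (x y : Fin n) (A : Set X) :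
    kOp τ x (kOp τ y A) = kOp τ (max x y) A := by
  apply Set.Subset.antisymm
  · calc kOp τ x (kOp τ y A) ⊆ kOp τ (max x y) (kOp τ y A) := hp.kOp_subset (le_max_left x y) _
      _ ⊆ kOp τ (max x y) (kOp τ (max x y) A) :=
        kOp_mono _ (hp.kOp_subset (le_max_right x y) _)
      _ = _ := kOp_idem _ _
  · rcases le_total x y with h | h
    · rw [max_eq_right h]; exact subset_kOp _ _
    · rw [max_eq_left h]; exact kOp_mono _ (subset_kOp _ _)

theorem IsPolytopological.iOp_iOp (hp : IsPolytopological τ) (x y : Fin n) (A : Set X) :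
    iOp τ x (iOp τ y A) = iOp τ (max x y) A := by
  have := hp.kOp_kOp x y Aᶜ
  rwa [kOp_compl, kOp_compl, kOp_compl, compl_inj_iff] at this

/-- The part of `U` outside this closure is τ_x-open; if nonempty, it would have τ_y-interior
points, which belong to `iOp τ y U`. -/
theorem IsSaturated.subset_kOp_iOp (hs : IsSaturated τ) (x y : Fin n) {U : Set X}
    (hU : IsOpen[τ x] U) : U ⊆ kOp τ x (iOp τ y U) := by
  have hopen : IsOpen[τ x] (U ∩ (kOp τ x (iOp τ y U))ᶜ) :=
    @IsOpen.inter X (τ x) _ _ hU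
      ((@isOpen_compl_iff X _ (τ x)).2 (@isClosed_closure X (τ x) _))
  by_contra hsub
  obtain ⟨a, ha, hna⟩ := Set.not_subset.1 hsub
  obtain ⟨b, hb⟩ := hs x y _ hopen ⟨a, ha, hna⟩
  have h1 : b ∈ iOp τ y U := iOp_mono y Set.inter_subset_left hb
  exact (iOp_subset y _ hb).2 (subset_kOp x _ h1)

/-- By saturation each τ_a-interior lies in the τ_a-closure of any other interior; comparability of
the topologies then gives both inclusions. -/
theorem kOp_iOp (hp : IsPolytopological τ) (hs : IsSaturated τ) (x y : Fin n) (A : Set X) :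
    kOp τ x (iOp τ y A) = kOp τ x (iOp τ x A) := by
  have key : ∀ a b : Fin n, iOp τ a A ⊆ kOp τ a (iOp τ b A) := fun a b =>
    (hs.subset_kOp_iOp a b (@isOpen_interior X (τ a) A)).trans
      (kOp_mono a (iOp_mono b (iOp_subset a A)))
  have absorb : ∀ {B C : Set X}, B ⊆ kOp τ x C → kOp τ x B ⊆ kOp τ x C := fun h =>
    (kOp_mono x h).trans (kOp_idem x _).subset
  apply Set.Subset.antisymm
  · rcases le_total x y with h | h
    · exact kOp_mono x (hp.iOp_subset_iOp h A)
    · exact absorb ((key y x).trans (hp.kOp_subset h _))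
  · exact absorb (key x y)

theorem iOp_kOp (hp : IsPolytopological τ) (hs : IsSaturated τ) (x y : Fin n) (A : Set X) :
    iOp τ x (kOp τ y A) = iOp τ x (kOp τ x A) := by
  have := kOp_iOp hp hs x y Aᶜ
  rwa [iOp_compl, iOp_compl, kOp_compl, kOp_compl, compl_inj_iff] at this

/-- A frontier is an intersection of two closures, interior commutes with it, and `iOp_kOp` applies
to both factors. -/
theorem iOp_fOp (hp : IsPolytopological τ) (hs : IsSaturated τ) (x y : Fin n) (A : Set X) :
    iOp τ x (fOp τ y A) = iOp τ x (fOp τ x A) := by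
  have key : ∀ z, iOp τ x (fOp τ z A) = iOp τ x (kOp τ z A) ∩ iOp τ x (kOp τ z Aᶜ) := fun z => by
    rw [fOp_eq_diff, Set.sdiff_eq, ← kOp_compl]
    exact @interior_inter X (τ x) _ _
  rw [key, key, iOp_kOp hp hs x y, iOp_kOp hp hs x y]

/-- For y ≤ x both halves of the frontier forget y. This is the source of the constraint x ≤ y in
`Word.Ordered`. -/
theorem fOp_kOp (hp : IsPolytopological τ) (hs : IsSaturated τ) (x y : Fin n) (A : Set X) :
    fOp τ x (kOp τ y A) = fOp τ x (kOp τ (max x y) A) := by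
  rcases le_total x y with h | h
  · rw [max_eq_right h]
  · rw [max_eq_left h, fOp_eq_diff, fOp_eq_diff, hp.kOp_kOp, hp.kOp_kOp, max_eq_left h, max_self,
      iOp_kOp hp hs]

theorem fOp_iOp (hp : IsPolytopological τ) (hs : IsSaturated τ) (x y : Fin n) (A : Set X) :
    fOp τ x (iOp τ y A) = fOp τ x (iOp τ (max x y) A) := by
  have := fOp_kOp hp hs x y Aᶜ
  rwa [kOp_compl, kOp_compl, fOp_compl, fOp_compl] at this

/-- Clear for τ_z; saturation transfers it to the other topologies. A further frontier then acts as
a closure, so no word needs three frontiers. -/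
theorem iOp_fOp_of_isOpen_or_isClosed (hp : IsPolytopological τ) (hs : IsSaturated τ)
    (x y z : Fin n) {Z : Set X} (hZ : IsOpen[τ z] Z ∨ IsClosed[τ z] Z) :
    iOp τ x (fOp τ y Z) = ∅ := by
  have hz : iOp τ z (fOp τ z Z) = ∅ := by
    rcases hZ with h | h
    · have := @interior_frontier X (τ z) Zᶜ ((@isClosed_compl_iff X (τ z) _).2 h)
      rwa [@frontier_compl X (τ z)] at this
    · exact @interior_frontier X (τ z) Z h
  rw [iOp_fOp hp hs, ← iOp_fOp hp hs x z]
  by_contra hne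
  obtain ⟨a, ha⟩ := hs x z _ (@isOpen_interior X (τ x) _) (Set.nonempty_iff_ne_empty.2 hne)
  have : a ∈ iOp τ z (fOp τ z Z) := iOp_mono z (iOp_subset x _) ha
  rw [hz] at this
  exact this

theorem iOp_kOp_fOp (hp : IsPolytopological τ) (hs : IsSaturated τ) (x w y : Fin n) (A : Set X) :
    iOp τ x (kOp τ w (fOp τ y A)) = iOp τ x (fOp τ x A) := by
  rw [iOp_kOp hp hs, ← iOp_kOp hp hs x y, kOp_fOp_self, iOp_fOp hp hs]

theorem iOp_kOp_iOp_fOp (x : Fin n) (A : Set X) :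
    iOp τ x (kOp τ x (iOp τ x (fOp τ x A))) = iOp τ x (fOp τ x A) := by
  conv_lhs => rw [← kOp_fOp_self x A]
  rw [iOp_kOp_iOp_kOp, kOp_fOp_self]

end Relations

/-! ### Words and their normal forms -/

/-- The shapes of the operators obtained from closures, interiors and one innermost frontier. -/
inductive Reg
  | k | i | ki | ik | iki | kik | iF | kiF
  deriving DecidableEq

instance : Fintype Reg :=
  ⟨{.k, .i, .ki, .ik, .iki, .kik, .iF, .kiF}, fun c => by cases c <;> decide⟩

/-- The shape of the operator with the same frontier, for shapes beginning with a redundant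
regularization. -/
def Reg.collapse : Reg → Reg
  | .iki => .ki
  | .kik => .ik
  | .kiF => .iF
  | c => c

/-- Words in closure, interior and frontier operators with indices in `α`. -/
inductive Word (α : Type)
  | one
  | zero
  | reg (c : Reg) (x : α)
  | kf (w x : α)
  | kfReg (c : Reg) (w x y : α)
  | kfkf (w x y z : α)
  deriving DecidableEq

section Eval

variable {α β : Type} {S S' : Type*}

/-- The value of a regular shape in an algebra with operators `k`, `i` and `f`. -/
def Reg.eval (k i f : α → S → S) : Reg → α → S → S
  | .k, x, s => k x s
  | .i, x, s => i x s
  | .ki, x, s => k x (i x s)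
  | .ik, x, s => i x (k x s)
  | .iki, x, s => i x (k x (i x s))
  | .kik, x, s => k x (i x (k x s))
  | .iF, x, s => i x (f x s)
  | .kiF, x, s => k x (i x (f x s))

/-- The value of a word in an algebra with operators `k`, `i`, `f` and a constant `e`. -/
def Word.eval (k i f : α → S → S) (e : S) : Word α → S → S
  | .one, s => s
  | .zero, _ => e
  | .reg c x, s => c.eval k i f x s
  | .kf w x, s => k w (f x s)
  | .kfReg c w x y, s => k w (f x (c.eval k i f y s))
  | .kfkf w x y z, s => k w (f x (k y (f z s)))

/-- Renaming of the indices of a word. -/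
def Word.map (φ : α → β) : Word α → Word β
  | .one => .one
  | .zero => .zero
  | .reg c x => .reg c (φ x)
  | .kf w x => .kf (φ w) (φ x)
  | .kfReg c w x y => .kfReg c (φ w) (φ x) (φ y)
  | .kfkf w x y z => .kfkf (φ w) (φ x) (φ y) (φ z)

theorem Word.map_id (v : Word α) : v.map id = v := by cases v <;> rfl

/-- Serves twice: to pass from sets of colors to sets of reals, and from the disjoint union to one
line, where `φ` merges indices. -/
theorem Word.eval_hom {k i f : α → S → S} {e : S} {k' i' f' : β → S' → S'} {e' : S'}
    (φ : α → β) (h : S → S') (hk : ∀ x s, h (k x s) = k' (φ x) (h s))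
    (hi : ∀ x s, h (i x s) = i' (φ x) (h s)) (hf : ∀ x s, h (f x s) = f' (φ x) (h s))
    (he : h e = e') (v : Word α) (s : S) :
    h (v.eval k i f e s) = (v.map φ).eval k' i' f' e' (h s) := by
  have hreg : ∀ (c : Reg) x s, h (c.eval k i f x s) = c.eval k' i' f' (φ x) (h s) := by
    intro c x s
    cases c <;> simp only [Reg.eval, hk, hi, hf]
  cases v <;> simp only [Word.eval, Word.map, hk, hf, he, hreg]

variable [LinearOrder α]

/-- The constraints on the indices of a word. -/
def Word.Ordered : Word α → Prop
  | .kf w x => x ≤ w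
  | .kfReg _ w x y => x ≤ w ∧ x ≤ y
  | .kfkf w x y z => x ≤ w ∧ x ≤ y ∧ z ≤ y
  | _ => True

instance : DecidablePred (Word.Ordered (α := α)) := fun v => by
  cases v <;> unfold Word.Ordered <;> infer_instance

/-- Normalization of a word whose indices are ordered. -/
def Word.norm : Word α → Word α
  | .kfReg c w x y => if x = y then .kfReg c.collapse w x y else .kfReg c w x y
  | v => v

/-- The words in normal form. -/
def Word.Normal (v : Word α) : Prop := v.Ordered ∧ v.norm = v

instance : DecidablePred (Word.Normal (α := α)) := fun v => by
  unfold Word.Normal; infer_instance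

theorem Reg.collapse_collapse (c : Reg) : c.collapse.collapse = c.collapse := by cases c <;> rfl

theorem Word.Ordered.normal_norm {v : Word α} (h : v.Ordered) : v.norm.Normal := by
  cases v with
  | kfReg c w x y =>
    by_cases hxy : x = y
    · simpa [Word.Normal, Word.norm, hxy, Reg.collapse_collapse, Word.Ordered] using h
    · simpa [Word.Normal, Word.norm, hxy, Word.Ordered] using h
  | _ => exact ⟨h, rfl⟩

/-- Left multiplication of a word by a closure operator. -/
def Word.kMul (j : α) : Word α → Word α
  | .one => .reg .k j
  | .zero => .zero
  | .reg .k x => .reg .k (max j x)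
  | .reg .i _ => .reg .ki j
  | .reg .ki x => .reg .ki (max j x)
  | .reg .ik _ => .reg .kik j
  | .reg .iki _ => .reg .ki j
  | .reg .kik x => .reg .kik (max j x)
  | .reg .iF _ => .reg .kiF j
  | .reg .kiF x => .reg .kiF (max j x)
  | .kf w x => .kf (max j w) x
  | .kfReg c w x y => .kfReg c (max j w) x y
  | .kfkf w x y z => .kfkf (max j w) x y z

/-- Left multiplication of a word by an interior operator. -/
def Word.iMul (j : α) : Word α → Word α
  | .one => .reg .i j
  | .zero => .zero
  | .reg .k _ => .reg .ik j
  | .reg .i x => .reg .i (max j x)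
  | .reg .ki _ => .reg .iki j
  | .reg .ik x => .reg .ik (max j x)
  | .reg .iki x => .reg .iki (max j x)
  | .reg .kik _ => .reg .ik j
  | .reg .iF x => .reg .iF (max j x)
  | .reg .kiF _ => .reg .iF j
  | .kf _ _ => .reg .iF j
  | .kfReg _ _ _ _ => .zero
  | .kfkf _ _ _ _ => .zero

/-- Left multiplication of a word by a frontier operator. -/
def Word.fMul (j : α) : Word α → Word α
  | .one => .kf j j
  | .zero => .zero
  | .reg c x => Word.norm (.kfReg c j j (max j x))
  | .kf w x => .kfkf j j (max j w) x
  | v => v.kMul j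

theorem Word.Normal.kMul {v : Word α} (h : v.Normal) (j : α) : (v.kMul j).Normal := by
  obtain ⟨h1, h2⟩ := h
  cases v with
  | reg c x => cases c <;> exact ⟨trivial, rfl⟩
  | kf w x => exact ⟨le_max_of_le_right h1, rfl⟩
  | kfkf w x y z => exact ⟨⟨le_max_of_le_right h1.1, h1.2⟩, rfl⟩
  | kfReg c w x y =>
    refine ⟨⟨le_max_of_le_right h1.1, h1.2⟩, ?_⟩
    by_cases hxy : x = y <;> simp_all [Word.norm, Word.kMul]
  | _ => exact ⟨trivial, rfl⟩

theorem Word.normal_iMul (v : Word α) (j : α) : (v.iMul j).Normal := by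
  cases v with
  | reg c x => cases c <;> exact ⟨trivial, rfl⟩
  | _ => exact ⟨trivial, rfl⟩

theorem Word.Normal.fMul {v : Word α} (h : v.Normal) (j : α) : (v.fMul j).Normal := by
  cases v with
  | reg c x =>
    exact Word.Ordered.normal_norm (v := .kfReg c j j (max j x)) ⟨le_rfl, le_max_left _ _⟩
  | kf w x => exact ⟨⟨le_rfl, le_max_left _ _, le_max_of_le_right h.1⟩, rfl⟩
  | kfReg c w x y => exact h.kMul j
  | kfkf w x y z => exact h.kMul j
  | one => exact ⟨le_rfl, rfl⟩
  | zero => exact ⟨trivial, rfl⟩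

end Eval

/-! ### Reduction of operators to normal words -/

section Upper

variable {X : Type*} {n : ℕ} {τ : Fin n → TopologicalSpace X}

/-- The set operator denoted by a word. -/
def Word.op (τ : Fin n → TopologicalSpace X) (v : Word (Fin n)) : SetOp X :=
  v.eval (kOp τ) (iOp τ) (fOp τ) ∅

/-- The set operator denoted by a regular shape. -/
abbrev Reg.op (τ : Fin n → TopologicalSpace X) (c : Reg) (x : Fin n) : SetOp X :=
  c.eval (kOp τ) (iOp τ) (fOp τ) x

theorem Reg.isOpen_or_isClosed_op (c : Reg) (x : Fin n) (A : Set X) :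
    IsOpen[τ x] (c.op τ x A) ∨ IsClosed[τ x] (c.op τ x A) := by
  cases c
  case i | ik | iki | iF => exact .inl (@isOpen_interior X (τ x) _)
  all_goals exact .inr (@isClosed_closure X (τ x) _)

/-- `collapse` identifies a regular closed set with its interior, and these have the same frontier.
-/
theorem fOp_collapse (c : Reg) (x : Fin n) (A : Set X) :
    fOp τ x (c.collapse.op τ x A) = fOp τ x (c.op τ x A) := by
  cases c <;>
    simp only [Reg.collapse, Reg.op, Reg.eval, fOp_eq_diff _ (kOp _ _ _), fOp_eq_diff _ (iOp _ _ _),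
      kOp_iOp_kOp_iOp, iOp_kOp_iOp_kOp, iOp_kOp_iOp_fOp, kOp_idem, iOp_idem]

theorem Word.op_norm (v : Word (Fin n)) : v.norm.op τ = v.op τ := by
  cases v with
  | kfReg c w x y =>
    by_cases hxy : x = y
    · subst hxy
      funext A
      simp only [Word.norm, if_true, Word.op, Word.eval]
      rw [fOp_collapse]
    · simp [Word.norm, hxy]
  | _ => rfl

variable (hp : IsPolytopological τ) (hs : IsSaturated τ)
include hp hs

theorem Word.op_kMul (v : Word (Fin n)) (j : Fin n) (A : Set X) :
    (v.kMul j).op τ A = kOp τ j (v.op τ A) := by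
  cases v with
  | one => rfl
  | zero => exact (@closure_empty X (τ j)).symm
  | reg c x =>
    cases c <;> simp only [Word.op, Word.kMul, Word.eval, Reg.eval]
    · rw [hp.kOp_kOp]
    · rw [kOp_iOp hp hs j x]
    · rw [hp.kOp_kOp, kOp_iOp hp hs _ x]
    · rw [kOp_iOp hp hs j x, iOp_kOp hp hs j x]
    · rw [kOp_iOp hp hs j x, iOp_kOp hp hs j x, kOp_iOp hp hs j x, kOp_iOp_kOp_iOp]
    · rw [hp.kOp_kOp, kOp_iOp hp hs _ x, iOp_kOp hp hs _ x]
    · rw [kOp_iOp hp hs j x, iOp_fOp hp hs j x]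
    · rw [hp.kOp_kOp, kOp_iOp hp hs _ x, iOp_fOp hp hs _ x]
  | _ => exact (hp.kOp_kOp _ _ _).symm

theorem Word.op_iMul (v : Word (Fin n)) (j : Fin n) (A : Set X) :
    (v.iMul j).op τ A = iOp τ j (v.op τ A) := by
  cases v with
  | one => rfl
  | zero => exact (@interior_empty X (τ j)).symm
  | reg c x =>
    cases c <;> simp only [Word.op, Word.iMul, Word.eval, Reg.eval]
    · rw [iOp_kOp hp hs j x]
    · rw [hp.iOp_iOp]
    · rw [iOp_kOp hp hs j x, kOp_iOp hp hs j x]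
    · rw [hp.iOp_iOp, iOp_kOp hp hs _ x]
    · rw [hp.iOp_iOp, iOp_kOp hp hs _ x, kOp_iOp hp hs _ x]
    · rw [iOp_kOp hp hs j x, kOp_iOp hp hs j x, iOp_kOp hp hs j x, iOp_kOp_iOp_kOp]
    · rw [hp.iOp_iOp, iOp_fOp hp hs _ x]
    · rw [iOp_kOp hp hs j x, kOp_iOp hp hs j x, iOp_fOp hp hs j x, iOp_kOp_iOp_fOp]
  | kf w x => exact (iOp_kOp_fOp hp hs j w x A).symm
  | kfReg c w x y =>
    simp only [Word.op, Word.iMul, Word.eval]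
    rw [iOp_kOp_fOp hp hs,
      iOp_fOp_of_isOpen_or_isClosed hp hs j j y (c.isOpen_or_isClosed_op y A)]
  | kfkf w x y z =>
    simp only [Word.op, Word.iMul, Word.eval]
    rw [iOp_kOp_fOp hp hs, iOp_fOp_of_isOpen_or_isClosed hp hs j j y
      (Z := kOp τ y (fOp τ z A)) (.inr (@isClosed_closure X (τ y) _))]

theorem fOp_reg (c : Reg) (x j : Fin n) (A : Set X) :
    fOp τ j (c.op τ x A) = fOp τ j (c.op τ (max j x) A) := by
  cases c <;> simp only [Reg.op, Reg.eval]
  · rw [fOp_kOp hp hs]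
  · rw [fOp_iOp hp hs]
  · rw [fOp_kOp hp hs, kOp_iOp hp hs _ x]
  · rw [fOp_iOp hp hs, iOp_kOp hp hs _ x]
  · rw [fOp_iOp hp hs, iOp_kOp hp hs _ x, kOp_iOp hp hs _ x]
  · rw [fOp_kOp hp hs, kOp_iOp hp hs _ x, iOp_kOp hp hs _ x]
  · rw [fOp_iOp hp hs, iOp_fOp hp hs _ x]
  · rw [fOp_kOp hp hs, kOp_iOp hp hs _ x, iOp_fOp hp hs _ x]

theorem Word.op_fMul (v : Word (Fin n)) (j : Fin n) (A : Set X) :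
    (v.fMul j).op τ A = fOp τ j (v.op τ A) := by
  cases v with
  | one => exact kOp_fOp_self j A
  | zero => exact (@frontier_empty X (τ j)).symm
  | reg c x =>
    rw [Word.fMul, Word.op_norm]
    simp only [Word.op, Word.eval]
    rw [kOp_fOp_self, fOp_reg hp hs c x]
  | kf w x =>
    simp only [Word.op, Word.fMul, Word.eval]
    rw [kOp_fOp_self, fOp_kOp hp hs j w]
  | kfReg c w x y =>
    -- The interior is empty, so the frontier is the closure.
    have h := Word.op_iMul hp hs (.kfReg c w x y) j A
    rw [fOp_eq_diff, ← h]
    exact (Word.op_kMul hp hs (.kfReg c w x y) j A).trans Set.sdiff_empty.symm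
  | kfkf w x y z =>
    have h := Word.op_iMul hp hs (.kfkf w x y z) j A
    rw [fOp_eq_diff, ← h]
    exact (Word.op_kMul hp hs (.kfkf w x y z) j A).trans Set.sdiff_empty.symm

theorem exists_normal_of_mem_KF₀ {o : SetOp X} (ho : o ∈ KF₀ τ) :
    ∃ v : Word (Fin n), v.Normal ∧ v.op τ = o := by
  induction ho using Submonoid.closure_induction_left with
  | one => exact ⟨.one, ⟨trivial, rfl⟩, rfl⟩
  | mul_left g hg o _ ih =>
    obtain ⟨v, hv, rfl⟩ := ih
    rcases hg with (⟨j, rfl⟩ | ⟨j, rfl⟩) | ⟨j, rfl⟩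
    · exact ⟨v.kMul j, hv.kMul j, funext fun A => Word.op_kMul hp hs v j A⟩
    · exact ⟨v.iMul j, v.normal_iMul j, funext fun A => Word.op_iMul hp hs v j A⟩
    · exact ⟨v.fMul j, hv.fMul j, funext fun A => Word.op_fMul hp hs v j A⟩

end Upper

/-! ### Counting the normal words -/

section Count

variable {n : ℕ}

/-- Parameters of the normal words, sorted by their shape. -/
abbrev NormalIndex (n : ℕ) : Type :=
  Unit ⊕ Unit ⊕ (Reg × Fin n) ⊕ (Σ x : Fin n, {w // w ∈ Finset.Ici x}) ⊕
    (Σ x : Fin n, {w // w ∈ Finset.Ici x} ×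
      (Σ c : Reg, {y // y ∈ if c.collapse = c then Finset.Ici x else Finset.Ioi x})) ⊕
    (Σ x : Fin n, {w // w ∈ Finset.Ici x} × (Σ y : {y // y ∈ Finset.Ici x},
      {z // z ∈ Finset.Iic y.1}))

theorem Word.normal_kfReg_iff (c : Reg) (w x y : Fin n) :
    (Word.kfReg c w x y).Normal ↔ w ∈ Finset.Ici x ∧
      y ∈ if c.collapse = c then Finset.Ici x else Finset.Ioi x := by
  rcases eq_or_ne x y with rfl | hxy
  · by_cases hc : c.collapse = c <;> simp [Word.Normal, Word.Ordered, Word.norm, hc]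
  · by_cases hc : c.collapse = c <;>
      simp [Word.Normal, Word.Ordered, Word.norm, hc, hxy, lt_iff_le_and_ne]

/-- The normal words are enumerated by their parameters. -/
def normalEquiv (n : ℕ) : {v : Word (Fin n) // v.Normal} ≃ NormalIndex n where
  toFun
    | ⟨.one, _⟩ => .inl ()
    | ⟨.zero, _⟩ => .inr (.inl ())
    | ⟨.reg c x, _⟩ => .inr (.inr (.inl (c, x)))
    | ⟨.kf w x, h⟩ => .inr (.inr (.inr (.inl ⟨x, w, Finset.mem_Ici.2 h.1⟩)))
    | ⟨.kfReg c w x y, h⟩ =>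
      have h' := (Word.normal_kfReg_iff c w x y).1 h
      .inr (.inr (.inr (.inr (.inl ⟨x, ⟨w, h'.1⟩, c, y, h'.2⟩))))
    | ⟨.kfkf w x y z, h⟩ => .inr (.inr (.inr (.inr (.inr
        ⟨x, ⟨w, Finset.mem_Ici.2 h.1.1⟩, ⟨y, Finset.mem_Ici.2 h.1.2.1⟩, z,
          Finset.mem_Iic.2 h.1.2.2⟩))))
  invFun
    | .inl _ => ⟨.one, trivial, rfl⟩
    | .inr (.inl _) => ⟨.zero, trivial, rfl⟩
    | .inr (.inr (.inl (c, x))) => ⟨.reg c x, trivial, rfl⟩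
    | .inr (.inr (.inr (.inl ⟨x, w, h⟩))) => ⟨.kf w x, Finset.mem_Ici.1 h, rfl⟩
    | .inr (.inr (.inr (.inr (.inl ⟨x, w, c, y⟩)))) =>
      ⟨.kfReg c w.1 x y.1, (Word.normal_kfReg_iff c w.1 x y.1).2 ⟨w.2, y.2⟩⟩
    | .inr (.inr (.inr (.inr (.inr ⟨x, w, y, z⟩)))) =>
      ⟨.kfkf w.1 x y.1 z.1, ⟨Finset.mem_Ici.1 w.2, Finset.mem_Ici.1 y.2, Finset.mem_Iic.1 z.2⟩, rfl⟩
  left_inv := by rintro ⟨_ | _ | _ | _ | _ | _, _⟩ <;> rfl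
  right_inv := by rintro (_ | _ | _ | _ | _ | _) <;> rfl

instance : Fintype {v : Word (Fin n) // v.Normal} := Fintype.ofEquiv _ (normalEquiv n).symm

/-- The summand counts words by `x`: eight regular words, then `N - x` choices of `w`, alone, with a
shape and `y` (three shapes exclude `y = x`), or with `y` and `z`. Keeping `N` apart from `m`
permits induction. -/
theorem sum_range_polynomial (N : ℚ) (m : ℕ) :
    ∑ x ∈ Finset.range m, (8 + (N - x) + (N - x) * (8 * (N - x) - 3) +
        (N - x) * ((N * (N + 1) - x * (x + 1)) / 2)) =
      8 * m + 8 * N ^ 2 * m - 2 * N * m + (2 - 16 * N) * (m * (m - 1) / 2) +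
        8 * ((m - 1) * m * (2 * m - 1) / 6) +
        (N ^ 2 * (N + 1) * m - N * (N + 2) * (m * (m - 1) / 2) +
          (1 - N) * ((m - 1) * m * (2 * m - 1) / 6) + (m * (m - 1) / 2) ^ 2) / 2 := by
  induction m with
  | zero => simp
  | succ m ih =>
    rw [Finset.sum_range_succ, ih]
    push_cast
    ring

theorem sum_range_ite_le (x m : ℕ) (h : x ≤ m) :
    ∑ y ∈ Finset.range m, (if x ≤ y then (y + 1 : ℚ) else 0) =
      (m * (m + 1) - x * (x + 1)) / 2 := by
  induction m, h using Nat.le_induction with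
  | base =>
    rw [Finset.sum_eq_zero]
    · simp
    · intro y hy
      rw [if_neg (not_le.2 (Finset.mem_range.1 hy))]
  | succ m hm ih =>
    rw [Finset.sum_range_succ, ih, if_pos hm]
    push_cast
    ring

theorem sum_Ici_add_one (x : Fin n) :
    ∑ y : {y // y ∈ Finset.Ici x}, ((y.1 : ℕ) + 1 : ℚ) = ((n : ℚ) * (n + 1) - x * (x + 1)) / 2 := by
  rw [Finset.sum_coe_sort (Finset.Ici x) fun y => ((y : ℕ) + 1 : ℚ), ← sum_range_ite_le x n x.2.le,
    Finset.sum_range fun y => if (x : ℕ) ≤ y then (y + 1 : ℚ) else 0, ← Finset.sum_filter]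
  refine Finset.sum_congr ?_ fun _ _ => rfl
  ext y
  simp

theorem card_normal (n : ℕ) : (Fintype.card {v : Word (Fin n) // v.Normal} : ℚ) = p n := by
  have hreg : Fintype.card Reg = 8 := rfl
  have hsum : ∀ f : Reg → ℕ, ∑ c, f c = f .k + (f .i + (f .ki + (f .ik + (f .iki + (f .kik +
    (f .iF + f .kiF)))))) := fun f => rfl
  have hterm : ∀ x : Fin n, (((n - x : ℕ) + (n - x : ℕ) * ∑ c : Reg,
      (if c.collapse = c then Finset.Ici x else Finset.Ioi x).card +
      (n - x : ℕ) * ∑ y : {y // y ∈ Finset.Ici x}, ((y.1 : ℕ) + 1) : ℕ) : ℚ) =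
      (fun x : ℕ => ((n : ℚ) - x) + (n - x) * (8 * (n - x) - 3) +
        (n - x) * ((n * (n + 1) - x * (x + 1)) / 2)) x := by
    intro x
    rw [hsum]
    simp only [Reg.collapse, reduceCtorEq, if_true, if_false, Fin.card_Ici, Fin.card_Ioi]
    have h1 : ((n - x : ℕ) : ℚ) = n - (x : ℕ) := Nat.cast_sub x.2.le
    have h2 : ((n - 1 - x : ℕ) : ℚ) = n - 1 - (x : ℕ) := by
      rw [Nat.sub_sub, Nat.cast_sub (by omega)]
      push_cast
      ring
    have h3 := sum_Ici_add_one x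
    push_cast
    rw [h3, h1, h2]
    ring
  have hmain := sum_range_polynomial n n
  rw [Finset.sum_range] at hmain
  rw [Fintype.card_congr (normalEquiv n)]
  simp only [NormalIndex, Fintype.card_sum, Fintype.card_unit, Fintype.card_prod,
    Fintype.card_sigma, Fintype.card_coe, Fin.card_Ici, Fin.card_Iic, Fintype.card_fin, hreg]
  -- The `8 * n` regular words are spread over `x`, leaving a single sum.
  have hsplit : ∑ x : Fin n, (8 + ((n - x : ℕ) + (n - x : ℕ) * ∑ c : Reg,
      (if c.collapse = c then Finset.Ici x else Finset.Ioi x).card +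
      (n - x : ℕ) * ∑ y : {y // y ∈ Finset.Ici x}, ((y.1 : ℕ) + 1))) = 8 * n +
      (∑ x : Fin n, (n - x : ℕ) + (∑ x : Fin n, (n - x : ℕ) * ∑ c : Reg,
      (if c.collapse = c then Finset.Ici x else Finset.Ioi x).card +
      ∑ x : Fin n, (n - x : ℕ) * ∑ y : {y // y ∈ Finset.Ici x}, ((y.1 : ℕ) + 1))) := by
    rw [Finset.sum_add_distrib, Finset.sum_add_distrib, Finset.sum_add_distrib]
    simp [mul_comm, add_assoc]
  rw [← hsplit]
  push_cast at hterm ⊢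
  simp only [hterm]
  simp only [add_assoc] at hmain ⊢
  rw [hmain, p]
  ring

end Count

/-! ### Locally homogeneous colorings of the line -/

open Filter

theorem nhds_sorgenfreyLine (x : ℝ) : @nhds ℝ sorgenfreyLine x = 𝓝[≥] x := by
  apply le_antisymm
  · intro U hU
    obtain ⟨b, hb, hU⟩ := mem_nhdsGE_iff_exists_Ico_subset.1 hU
    have : IsOpen[sorgenfreyLine] (Set.Ico x b) :=
      TopologicalSpace.isOpen_generateFrom_of_mem ⟨x, b, rfl⟩
    exact Filter.mem_of_superset (@IsOpen.mem_nhds ℝ sorgenfreyLine x _ this ⟨le_rfl, hb⟩) hU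
  · rw [TopologicalSpace.nhds_generateFrom]
    refine le_iInf₂ fun s hs => le_principal_iff.2 ?_
    obtain ⟨hx, a, b, rfl⟩ := hs
    exact mem_of_superset (Ico_mem_nhdsGE hx.2) (Set.Ico_subset_Ico_left hx.1)

section Germs

theorem map_nhdsGT_of_strictMono {f : ℝ → ℝ} (hf : StrictMono f) (hc : Continuous f) (x : ℝ) :
    map f (𝓝[>] x) = 𝓝[>] (f x) := by
  apply le_antisymm
  · exact tendsto_nhdsWithin_iff.2 ⟨hc.continuousWithinAt,
      eventually_mem_nhdsWithin.mono fun y hy => hf hy⟩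
  · intro U hU
    obtain ⟨b, hb, hU⟩ := mem_nhdsGT_iff_exists_Ioo_subset.1 (mem_map.1 hU)
    refine mem_of_superset (Ioo_mem_nhdsGT (hf hb)) ?_
    refine (intermediate_value_Ioo (le_of_lt hb) hc.continuousOn).trans ?_
    rintro _ ⟨y, hy, rfl⟩
    exact hU hy

theorem map_nhdsLT_of_strictMono {f : ℝ → ℝ} (hf : StrictMono f) (hc : Continuous f) (x : ℝ) :
    map f (𝓝[<] x) = 𝓝[<] (f x) := by
  apply le_antisymm
  · exact tendsto_nhdsWithin_iff.2 ⟨hc.continuousWithinAt,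
      eventually_mem_nhdsWithin.mono fun y hy => hf hy⟩
  · intro U hU
    obtain ⟨b, hb, hU⟩ := mem_nhdsLT_iff_exists_Ioo_subset.1 (mem_map.1 hU)
    refine mem_of_superset (Ioo_mem_nhdsLT (hf hb)) ?_
    refine (intermediate_value_Ioo (le_of_lt hb) hc.continuousOn).trans ?_
    rintro _ ⟨y, hy, rfl⟩
    exact hU hy

/-- Turns the colors accumulating at an end of the line into those accumulating at a separating
point of `periodize`. -/
theorem map_arctan_atTop : map Real.arctan atTop = 𝓝[<] (Real.pi / 2) := by
  have h : Real.arctan = (fun x : Set.Ioo (-(Real.pi / 2)) (Real.pi / 2) => (x : ℝ)) ∘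
    Real.tanOrderIso.symm := rfl
  rw [h, ← map_map, OrderIso.map_atTop, map_coe_Ioo_atTop (by linarith [Real.pi_pos])]

theorem map_arctan_atBot : map Real.arctan atBot = 𝓝[>] (-(Real.pi / 2)) := by
  have h : Real.arctan = (fun x : Set.Ioo (-(Real.pi / 2)) (Real.pi / 2) => (x : ℝ)) ∘
    Real.tanOrderIso.symm := rfl
  rw [h, ← map_map, OrderIso.map_atBot, map_coe_Ioo_atBot (by linarith [Real.pi_pos])]

theorem map_add_right_nhdsGT (c x : ℝ) : map (· + c) (𝓝[>] x) = 𝓝[>] (x + c) :=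
  map_nhdsGT_of_strictMono (add_left_strictMono) (by fun_prop) x

theorem map_add_right_nhdsLT (c x : ℝ) : map (· + c) (𝓝[<] x) = 𝓝[<] (x + c) :=
  map_nhdsLT_of_strictMono (add_left_strictMono) (by fun_prop) x

/-- The negative half-line as an increasing image of the line. -/
noncomputable def negExpNeg (y : ℝ) : ℝ := -Real.exp (-y)

theorem strictMono_negExpNeg : StrictMono negExpNeg := fun a b h => by
  simpa [negExpNeg] using h

theorem continuous_negExpNeg : Continuous negExpNeg := by unfold negExpNeg; fun_prop

theorem map_negExpNeg_atTop : map negExpNeg atTop = 𝓝[<] 0 := by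
  have h : negExpNeg = Neg.neg ∘ Real.exp ∘ Neg.neg := rfl
  rw [h, ← map_map, ← map_map, map_neg_atTop, Real.map_exp_atBot]
  apply le_antisymm
  · simp
  · simp

theorem map_negExpNeg_atBot : map negExpNeg atBot = atBot := by
  have h : negExpNeg = Neg.neg ∘ Real.exp ∘ Neg.neg := rfl
  rw [h, ← map_map, ← map_map, map_neg_atBot, Real.map_exp_atTop, map_neg_atTop]

end Germs

/-- The set of elements of `Fin N` encoded by the binary digits of `m`. -/
def maskSet {N : ℕ} (m : ℕ) : Set (Fin N) := {a | m.testBit a}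

theorem maskSet_lor {N : ℕ} (a b : ℕ) :
    (maskSet (a ||| b) : Set (Fin N)) = maskSet a ∪ maskSet b := by
  ext; simp [maskSet]

theorem maskSet_singleton {N : ℕ} (a : Fin N) : (maskSet (2 ^ (a : ℕ)) : Set (Fin N)) = {a} := by
  ext b; simp [maskSet, Nat.testBit_two_pow, Fin.ext_iff, eq_comm]

/-- A coloring `c` of the line by `Fin N` is locally homogeneous if the colors that accumulate at a
point from the right and from the left depend only on the color of the point, and are those of
`R` and `L`; moreover `bot`, `top` and `all` are the colors that accumulate at the two ends, and the
colors that occur. -/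
structure LocallyHomogeneous {N : ℕ} (R L : Fin N → ℕ) (bot top all : ℕ) (c : ℝ → Fin N) :
    Prop where
  right : ∀ x, map c (𝓝[>] x) = 𝓟 (maskSet (R (c x)))
  left : ∀ x, map c (𝓝[<] x) = 𝓟 (maskSet (L (c x)))
  bot : map c atBot = 𝓟 (maskSet bot)
  top : map c atTop = 𝓟 (maskSet top)
  all : Set.range c = maskSet all

section Colorings

variable {N : ℕ} {R L : Fin N → ℕ} {b t a b' t' a' : ℕ} {c c' : ℝ → Fin N}

theorem locallyHomogeneous_const (p : Fin N) (hR : R p = 2 ^ (p : ℕ)) (hL : L p = 2 ^ (p : ℕ)) :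
    LocallyHomogeneous R L (2 ^ (p : ℕ)) (2 ^ (p : ℕ)) (2 ^ (p : ℕ)) fun _ => p := by
  constructor <;> intros <;> simp [maskSet_singleton, hR, hL, Filter.map_const]

/-- The coloring of the rational and the irrational numbers by two colors. -/
noncomputable def mix (p q : Fin N) : ℝ → Fin N :=
  open Classical in fun x => if Irrational x then q else p

theorem locallyHomogeneous_mix {p q : Fin N} {m : ℕ} (hm : m = 2 ^ (p : ℕ) ||| 2 ^ (q : ℕ))
    (hp : R p = m ∧ L p = m) (hq : R q = m ∧ L q = m) :
    LocallyHomogeneous R L m m m (mix p q) := by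
  have hset : (maskSet m : Set (Fin N)) = {p, q} := by
    rw [hm, maskSet_lor, maskSet_singleton, maskSet_singleton]; rfl
  have hmem : ∀ x, mix p q x ∈ ({p, q} : Set (Fin N)) := fun x => by
    unfold mix; split_ifs <;> simp
  -- Along any filter that meets both rationals and irrationals frequently, both colors accumulate.
  have key : ∀ l : Filter ℝ, (∃ᶠ x in l, Irrational x) → (∃ᶠ x in l, ¬ Irrational x) →
      map (mix p q) l = 𝓟 {p, q} := by
    intro l h1 h2
    apply le_antisymm
    · exact le_principal_iff.2 (mem_map.2 (Eventually.of_forall hmem))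
    · intro U hU
      rw [mem_principal]
      have hU : ∀ᶠ x in l, mix p q x ∈ U := hU
      obtain ⟨x, hx, hx'⟩ := (h1.and_eventually hU).exists
      obtain ⟨y, hy, hy'⟩ := (h2.and_eventually hU).exists
      rw [mix, if_pos hx] at hx'
      rw [mix, if_neg hy] at hy'
      rintro z (rfl | rfl) <;> assumption
  have hRL : ∀ x, R (mix p q x) = m ∧ L (mix p q x) = m := fun x => by
    unfold mix; split_ifs <;> assumption
  have hrat : ∀ x y : ℝ, x < y → ∃ z ∈ Set.Ioo x y, ¬ Irrational z := fun x y h => by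
    obtain ⟨z, hz⟩ := exists_rat_btwn h
    exact ⟨z, hz, by simp⟩
  have hirr : ∀ x y : ℝ, x < y → ∃ z ∈ Set.Ioo x y, Irrational z := fun x y h => by
    obtain ⟨z, hz, hz'⟩ := exists_irrational_btwn h
    exact ⟨z, hz', hz⟩
  have hGT : ∀ (P : ℝ → Prop), (∀ x y : ℝ, x < y → ∃ z ∈ Set.Ioo x y, P z) →
      ∀ x, ∃ᶠ z in 𝓝[>] x, P z := by
    intro P hP x
    refine (nhdsGT_basis x).frequently_iff.2 fun h => ?_
    intro hh
    obtain ⟨z, hz, hz'⟩ := hP _ _ hh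
    exact ⟨z, hz, hz'⟩
  have hLT : ∀ (P : ℝ → Prop), (∀ x y : ℝ, x < y → ∃ z ∈ Set.Ioo x y, P z) →
      ∀ x, ∃ᶠ z in 𝓝[<] x, P z := by
    intro P hP x
    refine (nhdsLT_basis x).frequently_iff.2 fun h => ?_
    intro hh
    obtain ⟨z, hz, hz'⟩ := hP _ _ hh
    exact ⟨z, hz, hz'⟩
  have htop : ∀ (P : ℝ → Prop), (∀ x y : ℝ, x < y → ∃ z ∈ Set.Ioo x y, P z) →
      ∃ᶠ z in atTop, P z := fun P hP => frequently_atTop.2 fun x => by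
    obtain ⟨z, hz, hz'⟩ := hP x (x + 1) (by linarith)
    exact ⟨z, hz.1.le, hz'⟩
  have hbot : ∀ (P : ℝ → Prop), (∀ x y : ℝ, x < y → ∃ z ∈ Set.Ioo x y, P z) →
      ∃ᶠ z in atBot, P z := fun P hP => frequently_atBot.2 fun x => by
    obtain ⟨z, hz, hz'⟩ := hP (x - 1) x (by linarith)
    exact ⟨z, hz.2.le, hz'⟩
  refine ⟨fun x => ?_, fun x => ?_, ?_, ?_, ?_⟩
  · rw [(hRL x).1, hset, key _ (hGT _ hirr x) (hGT _ hrat x)]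
  · rw [(hRL x).2, hset, key _ (hLT _ hirr x) (hLT _ hrat x)]
  · rw [hset, key _ (hbot _ hirr) (hbot _ hrat)]
  · rw [hset, key _ (htop _ hirr) (htop _ hrat)]
  · rw [hset]
    apply Set.Subset.antisymm
    · rintro _ ⟨x, rfl⟩; exact hmem x
    · rintro z (rfl | rfl)
      · exact ⟨0, by simp [mix]⟩
      · exact ⟨√2, by simp [mix, irrational_sqrt_two]⟩

/-- Two colorings of the line, transported to the two half-lines, and a color for the origin. -/
noncomputable def glue (c : ℝ → Fin N) (p : Fin N) (c' : ℝ → Fin N) (x : ℝ) : Fin N :=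
  if x < 0 then c (-Real.log (-x)) else if x = 0 then p else c' (Real.log x)

theorem glue_exp (c c' : ℝ → Fin N) (p : Fin N) : glue c p c' ∘ Real.exp = c' := by
  funext y
  simp [glue, (Real.exp_pos y).not_gt, (Real.exp_pos y).ne']

theorem glue_negExpNeg (c c' : ℝ → Fin N) (p : Fin N) : glue c p c' ∘ negExpNeg = c := by
  funext y
  simp [glue, negExpNeg, Real.exp_pos]

/-- The origin sees the upper end of `c` on its left and the lower end of `c'` on its right; `hL`
and `hR` say that the tables agree with this. -/
theorem LocallyHomogeneous.glue (h : LocallyHomogeneous R L b t a c)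
    (h' : LocallyHomogeneous R L b' t' a' c') (p : Fin N) (hL : L p = t) (hR : R p = b') :
    LocallyHomogeneous R L b t' (a ||| a' ||| 2 ^ (p : ℕ)) (glue c p c') := by
  have cases : ∀ P : ℝ → Prop, (∀ y, P (negExpNeg y)) → P 0 → (∀ y, P (Real.exp y)) → ∀ x, P x := by
    intro P h1 h2 h3 x
    rcases lt_trichotomy x 0 with hx | rfl | hx
    · have := h1 (-Real.log (-x))
      rwa [negExpNeg, neg_neg, Real.exp_log (neg_pos.2 hx), neg_neg] at this
    · exact h2
    · have := h3 (Real.log x)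
      rwa [Real.exp_log hx] at this
  have e1 : ∀ y, Polytopological.glue c p c' (Real.exp y) = c' y := congrFun (glue_exp c c' p)
  have e2 : ∀ y, Polytopological.glue c p c' (negExpNeg y) = c y := congrFun (glue_negExpNeg c c' p)
  have e0 : Polytopological.glue c p c' 0 = p := by simp [Polytopological.glue]
  refine ⟨cases _ (fun y => ?_) ?_ (fun y => ?_), cases _ (fun y => ?_) ?_ (fun y => ?_),
    ?_, ?_, ?_⟩
  · rw [← map_nhdsGT_of_strictMono strictMono_negExpNeg continuous_negExpNeg, map_map,
      glue_negExpNeg, e2, h.right]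
  · rw [← Real.map_exp_atBot, map_map, glue_exp, e0, h'.bot, hR]
  · rw [← map_nhdsGT_of_strictMono Real.exp_strictMono Real.continuous_exp, map_map,
      glue_exp, e1, h'.right]
  · rw [← map_nhdsLT_of_strictMono strictMono_negExpNeg continuous_negExpNeg, map_map,
      glue_negExpNeg, e2, h.left]
  · rw [← map_negExpNeg_atTop, map_map, glue_negExpNeg, e0, h.top, hL]
  · rw [← map_nhdsLT_of_strictMono Real.exp_strictMono Real.continuous_exp, map_map,
      glue_exp, e1, h'.left]
  · rw [← map_negExpNeg_atBot, map_map, glue_negExpNeg, h.bot]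
  · rw [← Real.map_exp_atTop, map_map, glue_exp, h'.top]
  · rw [maskSet_lor, maskSet_lor, maskSet_singleton, ← h.all, ← h'.all]
    apply Set.Subset.antisymm
    · rintro _ ⟨x, rfl⟩
      revert x
      refine cases _ (fun y => ?_) ?_ (fun y => ?_)
      · rw [e2]; exact .inl (.inl ⟨y, rfl⟩)
      · rw [e0]; exact .inr rfl
      · rw [e1]; exact .inl (.inr ⟨y, rfl⟩)
    · rintro _ ((⟨y, rfl⟩ | ⟨y, rfl⟩) | rfl)
      · exact ⟨_, e2 y⟩
      · exact ⟨_, e1 y⟩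
      · exact ⟨0, e0⟩

/-- The periodic coloring composed of copies of a coloring of the line, separated by points of one
color. -/
noncomputable def periodize (c : ℝ → Fin N) (p : Fin N) (x : ℝ) : Fin N :=
  if Real.cos x = 0 then p else c (Real.tan x)

theorem periodize_arctan (c : ℝ → Fin N) (p : Fin N) : periodize c p ∘ Real.arctan = c := by
  funext y
  simp [periodize, (Real.cos_arctan_pos y).ne']

theorem periodize_periodic (c : ℝ → Fin N) (p : Fin N) :
    Function.Periodic (periodize c p) Real.pi := fun x => by
  simp [periodize, Real.cos_add_pi, Real.tan_add_pi]

/-- A zero of the cosine sees the upper end of one copy and the lower end of the next. By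
periodicity every color recurs towards both ends, so the three masks coincide. -/
theorem LocallyHomogeneous.periodize (h : LocallyHomogeneous R L b t a c) (p : Fin N)
    (hL : L p = t) (hR : R p = b) :
    LocallyHomogeneous R L (a ||| 2 ^ (p : ℕ)) (a ||| 2 ^ (p : ℕ)) (a ||| 2 ^ (p : ℕ))
      (periodize c p) := by
  set g := Polytopological.periodize c p with hg
  have hper : Function.Periodic g Real.pi := periodize_periodic c p
  have e1 : ∀ y, g (Real.arctan y) = c y := congrFun (periodize_arctan c p)
  have e0 : g (Real.pi / 2) = p := by simp [hg, Polytopological.periodize]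
  have cases : ∀ P : ℝ → Prop, (∀ y, P (y + Real.pi) ↔ P y) → (∀ y, P (Real.arctan y)) →
      P (Real.pi / 2) → ∀ x, P x := by
    intro P h1 h2 h3 x
    have hP : Function.Periodic P Real.pi := fun y => propext (h1 y)
    obtain ⟨y, hy, hxy⟩ := hP.exists_mem_Ioc Real.pi_pos x (-(Real.pi / 2))
    rw [hxy]
    rcases hy.2.lt_or_eq with hlt | heq
    · rw [← Real.arctan_tan hy.1 (by linarith)]; exact h2 _
    · rw [heq, show -(Real.pi / 2) + Real.pi = Real.pi / 2 by ring]; exact h3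
  have hcomp : g ∘ (· + Real.pi) = g := funext hper
  have hrange : Set.range g = maskSet (a ||| 2 ^ (p : ℕ)) := by
    rw [maskSet_lor, maskSet_singleton, ← h.all]
    apply Set.Subset.antisymm
    · rintro _ ⟨x, rfl⟩
      revert x
      refine cases _ (fun y => by rw [hper]) (fun y => ?_) ?_
      · rw [e1]; exact .inl ⟨y, rfl⟩
      · rw [e0]; exact .inr rfl
    · rintro _ (⟨y, rfl⟩ | rfl)
      · exact ⟨_, e1 y⟩
      · exact ⟨_, e0⟩
  have hends : ∀ l : Filter ℝ, (∀ x, ∃ᶠ y in l, g y = g x) →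
      map g l = 𝓟 (maskSet (a ||| 2 ^ (p : ℕ))) := by
    intro l hl
    rw [← hrange]
    apply le_antisymm
    · exact le_principal_iff.2 (mem_map.2 (Eventually.of_forall fun x => ⟨x, rfl⟩))
    · intro U hU
      rw [mem_principal]
      rintro _ ⟨x, rfl⟩
      have hU : ∀ᶠ x in l, g x ∈ U := hU
      obtain ⟨y, hy, hy'⟩ := ((hl x).and_eventually hU).exists
      rwa [← hy]
  refine ⟨cases _ (fun y => ?_) (fun y => ?_) ?_, cases _ (fun y => ?_) (fun y => ?_) ?_,
    hends _ fun x => ?_, hends _ fun x => ?_, hrange⟩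
  · rw [← map_add_right_nhdsGT, map_map, hcomp, hper]
  · rw [← map_nhdsGT_of_strictMono Real.arctan_strictMono Real.continuous_arctan, map_map,
      periodize_arctan, e1, h.right]
  -- The right germ at π/2 is the translate of that at -π/2, the lower end of the image of `arctan`.
  · rw [← hper.sub_eq (Real.pi / 2)] at e0
    rw [show Real.pi / 2 = -(Real.pi / 2) + Real.pi by ring, ← map_add_right_nhdsGT, map_map, hcomp,
      ← map_arctan_atBot, map_map, periodize_arctan, hper,
      show -(Real.pi / 2) = Real.pi / 2 - Real.pi by ring, e0, hR, h.bot]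
  · rw [← map_add_right_nhdsLT, map_map, hcomp, hper]
  · rw [← map_nhdsLT_of_strictMono Real.arctan_strictMono Real.continuous_arctan, map_map,
      periodize_arctan, e1, h.left]
  · rw [← map_arctan_atTop, map_map, periodize_arctan, e0, hL, h.top]
  · refine frequently_atBot.2 fun z => ?_
    obtain ⟨y, hy, hxy⟩ := hper.exists_mem_Ico Real.pi_pos x (z - Real.pi)
    exact ⟨y, by linarith [hy.2], hxy.symm⟩
  · refine frequently_atTop.2 fun z => ?_
    obtain ⟨y, hy, hxy⟩ := hper.exists_mem_Ico Real.pi_pos x z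
    exact ⟨y, hy.1, hxy.symm⟩

theorem LocallyHomogeneous.map_nhdsGE (h : LocallyHomogeneous R L b t a c) (x : ℝ) :
    map c (𝓝[≥] x) = 𝓟 (maskSet (R (c x) ||| 2 ^ (c x : ℕ))) := by
  rw [← Set.Ioi_insert, nhdsWithin_insert, Filter.map_sup, h.right, map_pure, maskSet_lor,
    maskSet_singleton, ← sup_principal, sup_comm, principal_singleton]

theorem LocallyHomogeneous.map_nhds (h : LocallyHomogeneous R L b t a c) (x : ℝ) :
    map c (𝓝 x) = 𝓟 (maskSet (L (c x) ||| (R (c x) ||| 2 ^ (c x : ℕ)))) := by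
  rw [← nhdsLT_sup_nhdsGE, Filter.map_sup, h.left, h.map_nhdsGE, maskSet_lor (L _), sup_principal]

end Colorings

/-! ### Topological operators on sets of colors -/

section Masks

variable {N : ℕ}

/-- The encoding of the complement of a set encoded by `m`. -/
def maskCompl (N m : ℕ) : ℕ := (2 ^ N - 1) ^^^ m

/-- The encoding of the closure of a set, when `U` encodes the least neighborhoods of the points. -/
def maskClosure (U : Fin N → ℕ) (m : ℕ) : ℕ := Nat.ofBits fun a : Fin N => U a &&& m != 0

/-- The encoding of the interior of a set. -/
def maskInterior (U : Fin N → ℕ) (m : ℕ) : ℕ := maskCompl N (maskClosure U (maskCompl N m))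

/-- The encoding of the frontier of a set. -/
def maskFrontier (U : Fin N → ℕ) (m : ℕ) : ℕ := maskClosure U m &&& maskClosure U (maskCompl N m)

theorem maskSet_maskCompl (m : ℕ) : (maskSet (maskCompl N m) : Set (Fin N)) = (maskSet m)ᶜ := by
  ext a
  simp [maskSet, maskCompl, Nat.testBit_xor, Nat.testBit_two_pow_sub_one]

theorem maskSet_land (m m' : ℕ) :
    (maskSet (m &&& m') : Set (Fin N)) = maskSet m ∩ maskSet m' := by
  ext; simp [maskSet]

theorem mem_maskSet_maskClosure {U : Fin N → ℕ} (hU : ∀ a, U a < 2 ^ N) (m : ℕ) (a : Fin N) :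
    a ∈ maskSet (maskClosure U m) ↔ ∃ b : Fin N, b ∈ maskSet (U a) ∧ b ∈ maskSet m := by
  have h : a ∈ maskSet (maskClosure U m) ↔ U a &&& m ≠ 0 := by
    simp [maskSet, maskClosure, Nat.testBit_ofBits_lt]
  rw [h]
  constructor
  · intro h
    obtain ⟨i, hi⟩ := Nat.exists_testBit_of_ne_zero h
    rw [Nat.testBit_and, Bool.and_eq_true] at hi
    have : i < N := by
      by_contra hlt
      rw [Nat.testBit_lt_two_pow ((hU a).trans_le (Nat.pow_le_pow_right two_pos (not_lt.1 hlt)))]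
        at hi
      exact absurd hi.1 (by simp)
    exact ⟨⟨i, this⟩, hi⟩
  · rintro ⟨b, h1, h2⟩ h0
    have := Nat.testBit_and (U a) m b
    rw [h0, show (U a).testBit b = true from h1, show m.testBit b = true from h2] at this
    simp at this

variable {t : TopologicalSpace ℝ} {c : ℝ → Fin N} {U : Fin N → ℕ}

/-- Along a principal filter, occurring frequently means occurring at all, so the finite table `U`
decides the closure. -/
theorem closure_preimage_maskSet (hU : ∀ a, U a < 2 ^ N)
    (h : ∀ x, map c (@nhds ℝ t x) = 𝓟 (maskSet (U (c x)))) (m : ℕ) :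
    @closure ℝ t (c ⁻¹' maskSet m) = c ⁻¹' maskSet (maskClosure U m) := by
  ext x
  rw [@mem_closure_iff_frequently ℝ t, Set.mem_preimage, mem_maskSet_maskClosure hU]
  have : (∃ᶠ y in @nhds ℝ t x, y ∈ c ⁻¹' maskSet m) ↔
    ∃ᶠ b in map c (@nhds ℝ t x), b ∈ maskSet m := Iff.rfl
  rw [this, h, frequently_principal]

theorem interior_preimage_maskSet (hU : ∀ a, U a < 2 ^ N)
    (h : ∀ x, map c (@nhds ℝ t x) = 𝓟 (maskSet (U (c x)))) (m : ℕ) :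
    @interior ℝ t (c ⁻¹' maskSet m) = c ⁻¹' maskSet (maskInterior U m) := by
  rw [maskInterior, maskSet_maskCompl, Set.preimage_compl, ← closure_preimage_maskSet hU h,
    maskSet_maskCompl, Set.preimage_compl, @closure_compl ℝ t, compl_compl]

theorem frontier_preimage_maskSet (hU : ∀ a, U a < 2 ^ N)
    (h : ∀ x, map c (@nhds ℝ t x) = 𝓟 (maskSet (U (c x)))) (m : ℕ) :
    @frontier ℝ t (c ⁻¹' maskSet m) = c ⁻¹' maskSet (maskFrontier U m) := by
  rw [@frontier_eq_closure_inter_closure ℝ t, maskFrontier, maskSet_land, Set.preimage_inter,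
    ← closure_preimage_maskSet hU h, ← closure_preimage_maskSet hU h, maskSet_maskCompl,
    Set.preimage_compl]

end Masks

/-! ### The 15-coloring and the case of two letters -/

section Model

/-- The colors that accumulate from the right at the points of a given color. -/
def rightColors : Fin 15 → ℕ :=
  ![1, 2, 12, 12, 2, 1, 1, 65, 12, 2, 2, 1026, 782, 51, 12]

/-- The colors that accumulate from the left at the points of a given color. -/
def leftColors : Fin 15 → ℕ :=
  ![1, 2, 12, 12, 1, 2, 1, 51, 2, 12, 2, 782, 65, 1026, 16383]

/-- A coloring of the line whose color classes generate enough sets. -/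
noncomputable def coloring : ℝ → Fin 15 :=
  glue (periodize (glue
      (glue (periodize (glue (fun _ => 0) 4 (fun _ => 1)) 5) 7 (periodize (fun _ => 0) 6)) 12
      (glue (periodize (glue (fun _ => 1) 8 (mix 2 3)) 9) 11 (periodize (fun _ => 1) 10))) 13) 14
    (mix 2 3)

/-- The table entries are end masks of the pieces meeting at a color: 51 = {0,1,4,5}, 65 = {0,6},
782 = {1,2,3,8,9} and 1026 = {1,10} belong to the inner periodic blocks, 12 = {2,3} to the mixture,
and 16383 to the outer periodic block with the colors 0 to 13. -/
theorem locallyHomogeneous_coloring :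
    LocallyHomogeneous rightColors leftColors 16383 12 32767 coloring := by
  have ha : LocallyHomogeneous rightColors leftColors 1 1 1 fun _ => 0 :=
    locallyHomogeneous_const 0 rfl rfl
  have ho : LocallyHomogeneous rightColors leftColors 2 2 2 fun _ => 1 :=
    locallyHomogeneous_const 1 rfl rfl
  have hm : LocallyHomogeneous rightColors leftColors 12 12 12 (mix 2 3) :=
    locallyHomogeneous_mix rfl ⟨rfl, rfl⟩ ⟨rfl, rfl⟩
  exact (((((ha.glue ho 4 rfl rfl).periodize 5 rfl rfl).glue (ha.periodize 6 rfl rfl) 7 rfl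
    rfl).glue (((ho.glue hm 8 rfl rfl).periodize 9 rfl rfl).glue (ho.periodize 10 rfl rfl) 11 rfl
    rfl) 12 rfl rfl).periodize 13 rfl rfl).glue hm 14 rfl rfl

/-- The Sorgenfrey and the Euclidean topology of the line. -/
abbrev lineTopology : Fin 2 → TopologicalSpace ℝ := ![sorgenfreyLine, euclideanLine]

/-- The least neighborhoods of the colors. -/
def colorNhds (j : Fin 2) (a : Fin 15) : ℕ :=
  if j = 0 then rightColors a ||| 2 ^ (a : ℕ) else leftColors a ||| (rightColors a ||| 2 ^ (a : ℕ))

theorem map_coloring_nhds (j : Fin 2) (x : ℝ) :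
    map coloring (@nhds ℝ (lineTopology j) x) = 𝓟 (maskSet (colorNhds j (coloring x))) := by
  fin_cases j
  · exact (congrArg (map coloring) (nhds_sorgenfreyLine x)).trans
      (locallyHomogeneous_coloring.map_nhdsGE x)
  · exact locallyHomogeneous_coloring.map_nhds x

theorem colorNhds_lt (j : Fin 2) (a : Fin 15) : colorNhds j a < 2 ^ 15 := by
  revert j a; decide

/-- The set of colors denoted by a word, applied to the set `{0, 2, 5, 8, 10, 11}` that is encoded
by `3365`. -/
def Word.mask (v : Word (Fin 2)) : ℕ :=
  v.eval (fun j => maskClosure (colorNhds j)) (fun j => maskInterior (colorNhds j))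
    (fun j => maskFrontier (colorNhds j)) 0 3365

theorem Word.op_lineTopology (v : Word (Fin 2)) :
    v.op lineTopology (coloring ⁻¹' maskSet 3365) = coloring ⁻¹' maskSet v.mask := by
  have := Word.eval_hom (k' := kOp lineTopology) (i' := iOp lineTopology) (f' := fOp lineTopology)
    (e' := ∅) id (fun m => coloring ⁻¹' maskSet m)
    (fun j m => (closure_preimage_maskSet (colorNhds_lt j) (map_coloring_nhds j) m).symm)
    (fun j m => (interior_preimage_maskSet (colorNhds_lt j) (map_coloring_nhds j) m).symm)
    (fun j m => (frontier_preimage_maskSet (colorNhds_lt j) (map_coloring_nhds j) m).symm)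
    (e := 0) (by ext; simp [maskSet]) v 3365
  rw [Word.map_id] at this
  exact this.symm

theorem eq_of_preimage_maskSet_eq {m m' : ℕ} (hm : m < 2 ^ 15) (hm' : m' < 2 ^ 15)
    (h : coloring ⁻¹' maskSet m = coloring ⁻¹' maskSet m') : m = m' := by
  have hs : Function.Surjective coloring := by
    rw [← Set.range_eq_univ, locallyHomogeneous_coloring.all]
    ext a
    revert a
    simp only [maskSet, Set.mem_ofPred_eq, Set.mem_univ, iff_true]
    decide
  have h := hs.preimage_injective h
  refine Nat.eq_of_testBit_eq fun i => ?_
  by_cases hi : i < 15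
  · have := Set.ext_iff.1 h ⟨i, hi⟩
    exact Bool.eq_iff_iff.2 this
  · have : 2 ^ 15 ≤ 2 ^ i := Nat.pow_le_pow_right two_pos (not_lt.1 hi)
    rw [Nat.testBit_lt_two_pow (hm.trans_le this), Nat.testBit_lt_two_pow (hm'.trans_le this)]

/-- The words with ordered indices in two letters. -/
def orderedWords : List (Word (Fin 2)) :=
  let I : List (Fin 2) := [0, 1]
  let C : List Reg := [.k, .i, .ki, .ik, .iki, .kik, .iF, .kiF]
  ([Word.one, .zero] ++ C.flatMap (fun c => I.map (Word.reg c)) ++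
    I.flatMap (fun w => I.map (Word.kf w)) ++
    C.flatMap (fun c => I.flatMap fun w => I.flatMap fun x => I.map (Word.kfReg c w x)) ++
    I.flatMap (fun w => I.flatMap fun x => I.flatMap fun y => I.map (Word.kfkf w x y))).filter
      fun v => v.Ordered

theorem mem_orderedWords {v : Word (Fin 2)} (h : v.Ordered) : v ∈ orderedWords := by
  have hI : ∀ j : Fin 2, j ∈ [(0 : Fin 2), 1] := by decide
  have hC : ∀ c : Reg, c ∈ [Reg.k, .i, .ki, .ik, .iki, .kik, .iF, .kiF] := by decide
  refine List.mem_filter.2 ⟨?_, decide_eq_true h⟩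
  simp only [List.mem_append, List.mem_flatMap, List.mem_map]
  cases v with
  | one => simp
  | zero => simp
  | reg c x => exact .inl (.inl (.inl (.inr ⟨c, hC c, x, hI x, rfl⟩)))
  | kf w x => exact .inl (.inl (.inr ⟨w, hI w, x, hI x, rfl⟩))
  | kfReg c w x y => exact .inl (.inr ⟨c, hC c, w, hI w, x, hI x, y, hI y, rfl⟩)
  | kfkf w x y z => exact .inr ⟨w, hI w, x, hI x, y, hI y, z, hI z, rfl⟩

/-- The filtered list consists of the 60 = p(2) normal words; this computation is the core of
sharpness. -/
theorem nodup_mask : ((orderedWords.filter fun v => v.norm = v).map Word.mask).Nodup := by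
  decide +kernel

/-- Non-normal words matter because a threshold can identify x and y. Bit 1 never appears: points of
color 1 have Euclidean neighborhoods of that color alone, and it is outside the initial set. -/
theorem mask_orderedWords : ∀ v ∈ orderedWords,
    v.norm.mask = v.mask ∧ v.mask < 2 ^ 15 ∧ v.mask.testBit 1 = false := by
  decide +kernel

end Model

/-! ### Recovering a word from its two-letter images -/

section Threshold

variable {α β : Type}

/-- The list of the indices of a word. -/
def Word.indices : Word α → List α
  | .one => []
  | .zero => []
  | .reg _ x => [x]
  | .kf w x => [w, x]
  | .kfReg _ w x y => [w, x, y]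
  | .kfkf w x y z => [w, x, y, z]

theorem Word.indices_map (φ : α → β) (v : Word α) : (v.map φ).indices = v.indices.map φ := by
  cases v <;> rfl

theorem Word.indices_norm [LinearOrder α] (v : Word α) : v.norm.indices = v.indices := by
  cases v with
  | kfReg c w x y => by_cases h : x = y <;> simp [Word.norm, h, Word.indices]
  | _ => rfl

/-- The map to `Fin 2` that distinguishes the indices below `t` from the others. -/
def threshold {n : ℕ} (t : Fin (n + 1)) (x : Fin n) : Fin 2 := if (x : ℕ) < t then 0 else 1

variable {n : ℕ}

theorem threshold_mono (t : Fin (n + 1)) : Monotone (threshold t) := by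
  intro x y h
  have h : (x : ℕ) ≤ y := h
  unfold threshold
  split_ifs <;> omega

theorem threshold_castSucc_of_lt {x y : Fin n} (h : x < y) : threshold y.castSucc x = 0 := by
  have h : (x : ℕ) < y := h
  simp [threshold, h]

theorem threshold_castSucc_self (y : Fin n) : threshold y.castSucc y = 1 := by
  simp [threshold]

theorem eq_of_threshold_eq {x y : Fin n} (h : ∀ t, threshold t x = threshold t y) : x = y := by
  rcases lt_trichotomy x y with hlt | rfl | hlt
  · have := h y.castSucc
    rw [threshold_castSucc_of_lt hlt, threshold_castSucc_self] at this
    exact absurd this (by decide)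
  · rfl
  · have := h x.castSucc
    rw [threshold_castSucc_of_lt hlt, threshold_castSucc_self] at this
    exact absurd this (by decide)

theorem list_eq_of_map_threshold_eq : ∀ {l l' : List (Fin n)},
    (∀ t, l.map (threshold t) = l'.map (threshold t)) → l = l'
  | [], [], _ => rfl
  | [], _ :: _, h => by simpa using h 0
  | _ :: _, [], h => by simpa using h 0
  | x :: l, y :: l', h => by
    simp only [List.map_cons, List.cons.injEq] at h
    rw [eq_of_threshold_eq fun t => (h t).1, list_eq_of_map_threshold_eq fun t => (h t).2]

theorem Word.Ordered.map_threshold {v : Word (Fin n)} (h : v.Ordered) (t : Fin (n + 1)) :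
    (v.map (threshold t)).Ordered := by
  have hm := threshold_mono t
  cases v with
  | kf w x => exact hm h
  | kfReg c w x y => exact ⟨hm h.1, hm h.2⟩
  | kfkf w x y z => exact ⟨hm h.1, hm h.2.1, hm h.2.2⟩
  | _ => trivial

/-- Normalization keeps the indices, and thresholds separate them, so only the shape is left to
recover. -/
theorem Word.Normal.eq_of_threshold {u v : Word (Fin n)} (hu : u.Normal) (hv : v.Normal)
    (h : ∀ t, (u.map (threshold t)).norm = (v.map (threshold t)).norm) : u = v := by
  have hind : u.indices = v.indices := list_eq_of_map_threshold_eq fun t => by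
    simpa [Word.indices_norm, Word.indices_map] using congrArg Word.indices (h t)
  -- Threshold 0 sends every index to 1, which determines the shape up to `collapse`.
  have h0 := h 0
  cases u <;> cases v <;> simp only [Word.indices, List.cons.injEq, reduceCtorEq, and_false,
    and_true] at hind
  case one.one => rfl
  case one.zero => simp [Word.map, Word.norm] at h0
  case zero.one => simp [Word.map, Word.norm] at h0
  case zero.zero => rfl
  case reg.reg => simp_all [Word.map, Word.norm]
  case kf.kf => simp_all
  case kfkf.kfkf => simp_all
  case kfReg.kfReg c w x y c' w' x' y' =>
    obtain ⟨rfl, rfl, rfl⟩ := hind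
    rcases hu.1.2.eq_or_lt with rfl | hlt
    · have h1 : c.collapse = c := by simpa [Word.norm] using hu.2
      have h2 : c'.collapse = c' := by simpa [Word.norm] using hv.2
      have h3 : c.collapse = c'.collapse := by simpa [Word.map, Word.norm] using h0
      rw [← h1, h3, h2]
    -- The threshold at `y` keeps `x` and `y` apart, so no collapse occurs.
    · have h1 := h y.castSucc
      simp only [Word.map, threshold_castSucc_of_lt hlt, threshold_castSucc_self, Word.norm] at h1
      rw [if_neg (by decide), if_neg (by decide)] at h1
      rw [(Word.kfReg.inj h1).1]

end Threshold

theorem Word.norm_eq_of_op_eq {u v : Word (Fin 2)} (hu : u.Ordered) (hv : v.Ordered)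
    (h : u.op lineTopology (coloring ⁻¹' maskSet 3365) =
      v.op lineTopology (coloring ⁻¹' maskSet 3365)) : u.norm = v.norm := by
  rw [Word.op_lineTopology, Word.op_lineTopology] at h
  have hu' := mask_orderedWords u (mem_orderedWords hu)
  have hv' := mask_orderedWords v (mem_orderedWords hv)
  have hmem : ∀ {w : Word (Fin 2)}, w.Ordered →
      w.norm ∈ orderedWords.filter fun v => v.norm = v := fun hw =>
    List.mem_filter.2 ⟨mem_orderedWords hw.normal_norm.1, decide_eq_true hw.normal_norm.2⟩
  refine List.inj_on_of_nodup_map nodup_mask (hmem hu) (hmem hv) ?_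
  rw [hu'.1, hv'.1]
  exact eq_of_preimage_maskSet_eq hu'.2.1 hv'.2.1 h

/-! ### The monoids as ranges of normal words -/

section Generation

variable {X : Type*} {n : ℕ} {τ : Fin n → TopologicalSpace X}

theorem kOp_mem_KF₀ (j : Fin n) : kOp τ j ∈ KF₀ τ :=
  Submonoid.subset_closure (.inl (.inl ⟨j, rfl⟩))

theorem iOp_mem_KF₀ (j : Fin n) : iOp τ j ∈ KF₀ τ :=
  Submonoid.subset_closure (.inl (.inr ⟨j, rfl⟩))

theorem fOp_mem_KF₀ (j : Fin n) : fOp τ j ∈ KF₀ τ :=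
  Submonoid.subset_closure (.inr ⟨j, rfl⟩)

theorem Reg.op_mem_KF₀ (c : Reg) (x : Fin n) : c.op τ x ∈ KF₀ τ := by
  have hk := kOp_mem_KF₀ (τ := τ) x
  have hi := iOp_mem_KF₀ (τ := τ) x
  have hf := fOp_mem_KF₀ (τ := τ) x
  cases c
  · exact hk
  · exact hi
  · exact mul_mem hk hi
  · exact mul_mem hi hk
  · exact mul_mem hi (mul_mem hk hi)
  · exact mul_mem hk (mul_mem hi hk)
  · exact mul_mem hi hf
  · exact mul_mem hk (mul_mem hi hf)

theorem Word.op_mem_KF₀ (hn : 1 ≤ n) (hp : IsPolytopological τ) (hs : IsSaturated τ)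
    (v : Word (Fin n)) : v.op τ ∈ KF₀ τ := by
  cases v with
  | one => exact one_mem _
  | zero =>
    -- The constant ∅ is i f k, which requires at least one topology.
    let j : Fin n := ⟨0, hn⟩
    have : Word.op τ .zero = iOp τ j * (fOp τ j * kOp τ j) := funext fun A =>
      (iOp_fOp_of_isOpen_or_isClosed hp hs j j j (Z := kOp τ j A)
        (.inr (@isClosed_closure X (τ j) A))).symm
    rw [this]
    exact mul_mem (iOp_mem_KF₀ j) (mul_mem (fOp_mem_KF₀ j) (kOp_mem_KF₀ j))
  | reg c x => exact c.op_mem_KF₀ x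
  | kf w x => exact mul_mem (kOp_mem_KF₀ w) (fOp_mem_KF₀ x)
  | kfReg c w x y =>
    exact mul_mem (kOp_mem_KF₀ w) (mul_mem (fOp_mem_KF₀ x) (c.op_mem_KF₀ y))
  | kfkf w x y z =>
    exact mul_mem (kOp_mem_KF₀ w) (mul_mem (fOp_mem_KF₀ x) (mul_mem (kOp_mem_KF₀ y)
      (fOp_mem_KF₀ z)))

theorem coe_KF₀_eq_range (hn : 1 ≤ n) (hp : IsPolytopological τ) (hs : IsSaturated τ) :
    (KF₀ τ : Set (SetOp X)) = Set.range fun v : {v : Word (Fin n) // v.Normal} => v.1.op τ := by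
  apply Set.Subset.antisymm
  · intro o ho
    obtain ⟨v, hv, rfl⟩ := exists_normal_of_mem_KF₀ hp hs ho
    exact ⟨⟨v, hv⟩, rfl⟩
  · rintro _ ⟨v, rfl⟩
    exact v.1.op_mem_KF₀ hn hp hs

theorem cOp_mem_KF : cOp X ∈ KF τ := Submonoid.subset_closure (.inr rfl)

theorem KF₀_le_KF : KF₀ τ ≤ KF τ := by
  have hk : ∀ j, kOp τ j ∈ KF τ := fun j => Submonoid.subset_closure (.inl (.inl ⟨j, rfl⟩))
  refine Submonoid.closure_le.2 ?_
  rintro _ ((⟨j, rfl⟩ | ⟨j, rfl⟩) | ⟨j, rfl⟩)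
  · exact hk j
  · have : iOp τ j = cOp X * (kOp τ j * cOp X) := funext fun A => by
      change iOp τ j A = (kOp τ j Aᶜ)ᶜ
      rw [kOp_compl, compl_compl]
    rw [this]
    exact mul_mem cOp_mem_KF (mul_mem (hk j) cOp_mem_KF)
  · exact Submonoid.subset_closure (.inl (.inr ⟨j, rfl⟩))

/-- Complements move to the far left: k c = c i, f c = f and c c = 1. -/
theorem mem_KF_iff {o : SetOp X} : o ∈ KF τ ↔ o ∈ KF₀ τ ∨ ∃ o' ∈ KF₀ τ, o = cOp X * o' := by
  constructor
  · intro ho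
    induction ho using Submonoid.closure_induction_left with
    | one => exact .inl (one_mem _)
    | mul_left g hg o _ ih =>
      rcases hg with (⟨j, rfl⟩ | ⟨j, rfl⟩) | rfl
      · rcases ih with ho | ⟨o, ho, rfl⟩
        · exact .inl (mul_mem (kOp_mem_KF₀ j) ho)
        · exact .inr ⟨iOp τ j * o, mul_mem (iOp_mem_KF₀ j) ho, funext fun A => kOp_compl j (o A)⟩
      · rcases ih with ho | ⟨o, ho, rfl⟩
        · exact .inl (mul_mem (fOp_mem_KF₀ j) ho)
        · have : fOp τ j * (cOp X * o) = fOp τ j * o := funext fun A => fOp_compl j (o A)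
          rw [this]
          exact .inl (mul_mem (fOp_mem_KF₀ j) ho)
      · rcases ih with ho | ⟨o, ho, rfl⟩
        · exact .inr ⟨o, ho, rfl⟩
        · have : cOp X * (cOp X * o) = o := funext fun A => compl_compl (o A)
          rw [this]
          exact .inl ho
  · rintro (ho | ⟨o, ho, rfl⟩)
    · exact KF₀_le_KF ho
    · exact mul_mem cOp_mem_KF (KF₀_le_KF ho)

/-- The operators denoted by the normal words, and their compositions with the complement. -/
def signedOp (τ : Fin n → TopologicalSpace X) :
    {v : Word (Fin n) // v.Normal} ⊕ {v : Word (Fin n) // v.Normal} → SetOp X :=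
  Sum.elim (fun v => v.1.op τ) fun v => cOp X * v.1.op τ

theorem coe_KF_eq_range (hn : 1 ≤ n) (hp : IsPolytopological τ) (hs : IsSaturated τ) :
    (KF τ : Set (SetOp X)) = Set.range (signedOp τ) := by
  ext o
  rw [SetLike.mem_coe, mem_KF_iff, signedOp, Set.Sum.elim_range, ← coe_KF₀_eq_range hn hp hs]
  refine or_congr Iff.rfl ⟨?_, ?_⟩
  · rintro ⟨o', ho', rfl⟩
    obtain ⟨v, hv, rfl⟩ := exists_normal_of_mem_KF₀ hp hs ho'
    exact ⟨⟨v, hv⟩, rfl⟩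
  · rintro ⟨v, rfl⟩
    exact ⟨_, v.1.op_mem_KF₀ hn hp hs, rfl⟩

theorem ncard_range_eq_card {α γ : Type*} [Fintype α] {f : α → γ} (hf : Function.Injective f) :
    (Set.range f).ncard = Fintype.card α := by
  rw [← Set.image_univ, Set.ncard_image_of_injective _ hf, Set.ncard_univ, Nat.card_eq_fintype_card]

/-- If a set separates the normal words and their complements, the monoids and the orbit of the set
have the largest possible size. -/
theorem ncard_of_injective (hn : 1 ≤ n) (hp : IsPolytopological τ) (hs : IsSaturated τ)
    {A : Set X} (hA : Function.Injective fun s => signedOp τ s A) :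
    ((KF₀ τ : Set (SetOp X)).ncard : ℚ) = p n ∧ ((KF τ : Set (SetOp X)).ncard : ℚ) = 2 * p n ∧
      ((orbit τ A).ncard : ℚ) = 2 * p n := by
  have hinj : Function.Injective (signedOp τ) := fun s s' h => hA (congrFun h A)
  have horbit : orbit τ A = Set.range fun s => signedOp τ s A := by
    ext B
    constructor
    · rintro ⟨o, ho, rfl⟩
      rw [← SetLike.mem_coe, coe_KF_eq_range hn hp hs] at ho
      obtain ⟨s, rfl⟩ := ho
      exact ⟨s, rfl⟩
    · rintro ⟨s, rfl⟩
      refine ⟨signedOp τ s, ?_, rfl⟩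
      rw [← SetLike.mem_coe, coe_KF_eq_range hn hp hs]
      exact ⟨s, rfl⟩
  have h₀ : Function.Injective fun v : {v : Word (Fin n) // v.Normal} => v.1.op τ :=
    hinj.comp Sum.inl_injective
  rw [horbit, coe_KF_eq_range hn hp hs, coe_KF₀_eq_range hn hp hs, ncard_range_eq_card hA,
    ncard_range_eq_card hinj, ncard_range_eq_card h₀, Fintype.card_sum]
  push_cast
  rw [card_normal]
  exact ⟨rfl, by ring, by ring⟩

end Generation

/-! ### The disjoint union of lines -/

section Lines

theorem nhds_lineTopology_le (j : Fin 2) (x : ℝ) : @nhds ℝ (lineTopology j) x ≤ 𝓝 x := by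
  fin_cases j
  · exact (nhds_sorgenfreyLine x).le.trans nhdsWithin_le_nhds
  · exact le_rfl

theorem le_nhds_lineTopology (j : Fin 2) (x : ℝ) : 𝓝[≥] x ≤ @nhds ℝ (lineTopology j) x := by
  fin_cases j
  · exact (nhds_sorgenfreyLine x).ge
  · exact nhdsWithin_le_nhds

theorem isOpen_lineTopology (j : Fin 2) {U : Set ℝ} (hU : IsOpen U) : IsOpen[lineTopology j] U :=
  (@isOpen_iff_mem_nhds ℝ (lineTopology j) U).2 fun x hx =>
    nhds_lineTopology_le j x (hU.mem_nhds hx)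

theorem isOpen_lineTopology_of_le {i j : Fin 2} (h : i ≤ j) {U : Set ℝ}
    (hU : IsOpen[lineTopology j] U) : IsOpen[lineTopology i] U := by
  rcases h.eq_or_lt with rfl | h
  · exact hU
  · obtain rfl : j = 1 := by omega
    exact isOpen_lineTopology i hU

variable {n : ℕ}

/-- On the copy of the line with index `t`, the first `t` topologies are Sorgenfrey topologies. -/
abbrev lines (t : Fin (n + 1)) (j : Fin n) : TopologicalSpace ℝ := lineTopology (threshold t j)

/-- The inclusion of the copy of the line with index `t`. -/
abbrev copyOfLine (t : Fin (n + 1)) : ℝ → Σ _ : Fin (n + 1), ℝ := fun x => ⟨t, x⟩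

theorem isPolytopological_lines : IsPolytopological (sumOfLines (lines (n := n))) := by
  intro i j h U hU
  rw [@isOpen_sigma_iff _ _ (fun t => lines t j)] at hU
  rw [@isOpen_sigma_iff _ _ (fun t => lines t i)]
  exact fun t => isOpen_lineTopology_of_le (threshold_mono t h) (hU t)

/-- A nonempty open set of either line topology contains some interval (x, b), which is open in
both. -/
theorem isSaturated_lines : IsSaturated (sumOfLines (lines (n := n))) := by
  rintro i j U hU ⟨⟨t, x⟩, hx⟩
  have hV : IsOpen[lineTopology (threshold t i)] (copyOfLine t ⁻¹' U) := by
    rw [@isOpen_sigma_iff _ _ (fun t => lines t i)] at hU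
    exact hU t
  obtain ⟨b, hb, hsub⟩ := mem_nhdsGE_iff_exists_Ico_subset.1
    (le_nhds_lineTopology _ x (@IsOpen.mem_nhds ℝ (lineTopology _) x _ hV hx))
  obtain ⟨y, hy⟩ := Set.nonempty_Ioo.2 (Set.mem_Ioi.1 hb)
  have hopen : IsOpen[sumOfLines lines j] (copyOfLine t '' Set.Ioo x b) :=
    @isOpenMap_sigmaMk _ _ (fun t => lines t j) t _ (isOpen_lineTopology _ isOpen_Ioo)
  have hsub' : copyOfLine t '' Set.Ioo x b ⊆ U := by
    rintro _ ⟨z, hz, rfl⟩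
    exact hsub ⟨hz.1.le, hz.2⟩
  have hint : copyOfLine t '' Set.Ioo x b ⊆ @interior _ (sumOfLines lines j) U :=
    @interior_maximal _ (sumOfLines lines j) _ _ hsub' hopen
  exact ⟨copyOfLine t y, hint (Set.mem_image_of_mem _ hy)⟩

/-- Each copy is an open subspace, so closure, interior and frontier restrict to it. -/
theorem Word.preimage_op (v : Word (Fin n)) (t : Fin (n + 1)) (A : Set (Σ _ : Fin (n + 1), ℝ)) :
    copyOfLine t ⁻¹' (v.op (sumOfLines lines) A) =
      (v.map (threshold t)).op lineTopology (copyOfLine t ⁻¹' A) := by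
  have ho : ∀ j, @IsOpenMap _ _ (lines t j) (sumOfLines lines j) (copyOfLine t) := fun j =>
    @isOpenMap_sigmaMk _ _ (fun t => lines t j) t
  have hc : ∀ j, @Continuous _ _ (lines t j) (sumOfLines lines j) (copyOfLine t) := fun j =>
    @continuous_sigmaMk _ _ (fun t => lines t j) t
  exact Word.eval_hom (k' := kOp lineTopology) (i' := iOp lineTopology) (f' := fOp lineTopology)
    (threshold t) (Set.preimage (copyOfLine t))
    (fun j B => @IsOpenMap.preimage_closure_eq_closure_preimage _ _ (copyOfLine t)
      (lines t j) (sumOfLines lines j) (ho j) (hc j) B)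
    (fun j B => @IsOpenMap.preimage_interior_eq_interior_preimage _ _ (copyOfLine t)
      (lines t j) (sumOfLines lines j) (ho j) (hc j) B)
    (fun j B => @IsOpenMap.preimage_frontier_eq_frontier_preimage _ _ (copyOfLine t)
      (lines t j) (sumOfLines lines j) (ho j) (hc j) B) rfl v A

/-- The set that consists of a copy of a fixed set of reals in each line. -/
def separatingSet (n : ℕ) : Set (Σ _ : Fin (n + 1), ℝ) := {q | coloring q.2 ∈ maskSet 3365}

theorem Word.Normal.eq_of_op_eq {u v : Word (Fin n)} (hu : u.Normal) (hv : v.Normal)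
    (h : u.op (sumOfLines lines) (separatingSet n) = v.op (sumOfLines lines) (separatingSet n)) :
    u = v :=
  hu.eq_of_threshold hv fun t => Word.norm_eq_of_op_eq (hu.1.map_threshold t)
    (hv.1.map_threshold t) (by
      have := congrArg (Set.preimage (copyOfLine t)) h
      rwa [Word.preimage_op, Word.preimage_op] at this)

theorem exists_notMem_op : ∃ q : Σ _ : Fin (n + 1), ℝ, ∀ v : Word (Fin n), v.Normal →
    q ∉ v.op (sumOfLines lines) (separatingSet n) := by
  have h1 : (1 : Fin 15) ∈ Set.range coloring := by
    rw [locallyHomogeneous_coloring.all, maskSet, Set.mem_ofPred_eq]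
    decide
  obtain ⟨x, hx⟩ := h1
  refine ⟨⟨0, x⟩, fun v hv hmem => ?_⟩
  have h : x ∈ copyOfLine 0 ⁻¹' (v.op (sumOfLines lines) (separatingSet n)) := hmem
  rw [Word.preimage_op] at h
  have h' : x ∈ (v.map (threshold 0)).op lineTopology (coloring ⁻¹' maskSet 3365) := h
  rw [Word.op_lineTopology, Set.mem_preimage, hx] at h'
  have := (mask_orderedWords _ (mem_orderedWords (hv.1.map_threshold 0))).2.2
  exact Bool.false_ne_true (this.symm.trans h')

theorem injective_signedOp_separatingSet :
    Function.Injective fun s => signedOp (sumOfLines (lines (n := n))) s (separatingSet n) := by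
  obtain ⟨q, hq⟩ := exists_notMem_op (n := n)
  rintro (⟨u, hu⟩ | ⟨u, hu⟩) (⟨v, hv⟩ | ⟨v, hv⟩) h
  · exact congrArg Sum.inl (Subtype.ext (hu.eq_of_op_eq hv h))
  -- The point `q` lies in neither value, so they are not complementary.
  · have h : u.op (sumOfLines lines) (separatingSet n) =
      (v.op (sumOfLines lines) (separatingSet n))ᶜ := h
    exact absurd (h ▸ hq v hv : q ∈ u.op (sumOfLines lines) (separatingSet n)) (hq u hu)
  · have h : (u.op (sumOfLines lines) (separatingSet n))ᶜ =
      v.op (sumOfLines lines) (separatingSet n) := h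
    exact absurd (h ▸ hq u hu : q ∈ v.op (sumOfLines lines) (separatingSet n)) (hq v hv)
  · exact congrArg Sum.inr (Subtype.ext (hu.eq_of_op_eq hv (compl_injective h)))

theorem lines_eq (t : Fin (n + 1)) (j : Fin n) :
    lines t j = sorgenfreyLine ∨ lines t j = euclideanLine := by
  unfold lines
  generalize threshold t j = i
  fin_cases i
  · exact .inl rfl
  · exact .inr rfl

end Lines

end Polytopological
theorem theorem2 (n : ℕ) (hn : 1 ≤ n) :
    ∃ (ι : Type) (σ : ι → Fin n → TopologicalSpace ℝ),
      (∀ (a : ι) (j : Fin n),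
        σ a j = Polytopological.sorgenfreyLine ∨ σ a j = Polytopological.euclideanLine) ∧
      Polytopological.IsPolytopological (Polytopological.sumOfLines σ) ∧
      Polytopological.IsSaturated (Polytopological.sumOfLines σ) ∧
      ((Polytopological.KF₀ (Polytopological.sumOfLines σ) :
        Set (Polytopological.SetOp (Σ _ : ι, ℝ))).ncard : ℚ) = Polytopological.p n ∧
      ((Polytopological.KF (Polytopological.sumOfLines σ) :
        Set (Polytopological.SetOp (Σ _ : ι, ℝ))).ncard : ℚ) = 2 * Polytopological.p n ∧
      ∃ A : Set (Σ _ : ι, ℝ),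
        ((Polytopological.orbit (Polytopological.sumOfLines σ) A).ncard : ℚ) =
          2 * Polytopological.p n := by
  obtain ⟨h₀, h, hA⟩ := Polytopological.ncard_of_injective hn
    Polytopological.isPolytopological_lines Polytopological.isSaturated_lines
    Polytopological.injective_signedOp_separatingSet
  exact ⟨Fin (n + 1), Polytopological.lines, Polytopological.lines_eq,
    Polytopological.isPolytopological_lines, Polytopological.isSaturated_lines, h₀, h, _, hA⟩
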